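/- Let $m\ge 1$ be a real number and $n\ge 1$ an integer with $m+n>2$. On $\mathbb{R}_+\times\mathbb{R}^n$, with points $(\rho,x)$, let $d\Lambda=\omega_m\rho^{m-1}\,d\rho\,dx$, where $\omega_m=2\pi^{m/2}/\Gamma(m/2)$. Let $\dot H^1_{\mathbb{C}}$ be the space of functions $\varphi:\mathbb{R}_+\times\mathbb{R}^n\to\mathbb{C}$ (identified when they agree $\Lambda$-almost everywhere) that have a distributional gradient $(\varphi_\rho,\nabla_x\varphi)$ on $\{\rho>0\}$ with $$\|\varphi\|_{\dot H^1}=\Big(\int\big(|\varphi_\rho|^2+|\nabla_x\varphi|^2\big)\,d\Lambda\Big)^{1/2}<\infty ,$$ and that satisfy $\Lambda(\{|\varphi|>\varepsilon\})<\infty$ for every $\varepsilon>0$. Let $(\varphi_j)$ be a bounded sequence in $\dot H^1_{\mathbb{C}}$. Suppose that there are $\varepsilon>0$, $R<\infty$ and $\delta>0$ such that $$\Lambda\big(\{(\rho,x): |\varphi_j(\rho,x)|>\varepsilon,\ \rho\le R\}\big)\ge\delta\qquad\text{for all } j .$$ Then there is a sequence $(x_j)\subseteq\mathbb{R}^n$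 such that the translates $\varphi_j^T(\rho,x):=\varphi_j(\rho,x+x_j)$ have a subsequence that converges weakly in $\dot H^1_{\mathbb{C}}$ to a nonzero element of $\dot H^1_{\mathbb{C}}$. -/

import Mathlib

open MeasureTheory Filter Topology
open scoped ContDiff

noncomputable section

namespace CylSobolev

/-- Points `(ρ, x)`, where `ρ` is a radial variable and `x ∈ ℝⁿ`. Functions are written on all of
`ℝ × ℝⁿ`, but only their values on the half-space `ρ > 0` matter in everything below. -/
abbrev Cyl (n : ℕ) : Type := ℝ × EuclideanSpace ℝ (Fin n)

/-- The open half-space `{(ρ, x) : ρ > 0}`. -/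
def halfSpace (n : ℕ) : Set (Cyl n) := {z | 0 < z.1}

/-- `ω_m = 2 π^{m/2} / Γ(m/2)`, the area of the unit sphere in (possibly fractional) dimension
`m > 0`. -/
def sphereArea (m : ℝ) : ℝ := 2 * Real.pi ^ (m / 2) / Real.Gamma (m / 2)

/-- The measure `dΛ = ω_m ρ^{m-1} dρ dx` on `{ρ > 0}`, extended by zero. -/
def Lam (m : ℝ) (n : ℕ) : Measure (Cyl n) :=
  (volume.restrict (halfSpace n)).withDensity
    (fun z => ENNReal.ofReal (sphereArea m * z.1 ^ (m - 1)))

/-- The coordinate directions: index `0` is the `ρ`-direction, index `i + 1` is the direction of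
the `i`-th coordinate of `x`. -/
def coordDir (n : ℕ) (i : Fin (n + 1)) : Cyl n :=
  Fin.cases ((1 : ℝ), 0) (fun k => ((0 : ℝ), EuclideanSpace.single k (1 : ℝ))) i

/-- `G = (φ_ρ, ∇ₓ φ)` is the distributional gradient of `φ` on the open half-space `ρ > 0`
(both being locally integrable there). -/
def HasDistGradient {n : ℕ} (φ : Cyl n → ℂ) (G : Cyl n → EuclideanSpace ℂ (Fin (n + 1))) : Prop :=
  LocallyIntegrableOn φ (halfSpace n) volume ∧
  LocallyIntegrableOn G (halfSpace n) volume ∧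
  ∀ η : Cyl n → ℝ, ContDiff ℝ ∞ η → HasCompactSupport η → tsupport η ⊆ halfSpace n →
    ∀ i : Fin (n + 1),
      ∫ z in halfSpace n, (fderiv ℝ η z (coordDir n i)) • φ z
        = - ∫ z in halfSpace n, (η z) • (G z i)

/-- Membership in `Ḣ¹_ℂ(ℝ₊ × ℝⁿ, ω_m ρ^{m-1} dρ dx)`: `φ` has a distributional gradient, the
gradient is square integrable for `Λ`, and `φ` is eventually zero. -/
def MemH1 (m : ℝ) (n : ℕ) (φ : Cyl n → ℂ) : Prop :=
  (∃ G : Cyl n → EuclideanSpace ℂ (Fin (n + 1)), HasDistGradient φ G ∧ MemLp G 2 (Lam m n)) ∧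
  ∀ ε : ℝ, 0 < ε → Lam m n {z | ε < ‖φ z‖} < ⊤

theorem integrable_mul_of_test {n : ℕ} {F : Type*} [NormedAddCommGroup F] [NormedSpace ℝ F]
    {f : Cyl n → F} (hf : LocallyIntegrableOn f (halfSpace n) volume)
    {g : Cyl n → ℝ} (hg : Continuous g) (hc : HasCompactSupport g)
    (hs : tsupport g ⊆ halfSpace n) :
    IntegrableOn (fun z => g z • f z) (halfSpace n) volume := by
  have h1 : IntegrableOn f (tsupport g) volume := hf.integrableOn_compact_subset hs hc
  have h2 : IntegrableOn (fun z => g z • f z) (tsupport g) volume :=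
    h1.continuousOn_smul hg.continuousOn hc
  have h3 : Integrable (fun z => g z • f z) volume := by
    rw [← integrableOn_iff_integrable_of_support_subset (s := tsupport g)]
    · exact h2
    · intro z hz
      apply subset_tsupport
      intro h0
      exact hz (by simp [h0])
  exact h3.integrableOn

theorem continuous_fderiv_dir {n : ℕ} {η : Cyl n → ℝ} (h : ContDiff ℝ ∞ η) (v : Cyl n) :
    Continuous (fun z => fderiv ℝ η z v) :=
  (h.continuous_fderiv (by simp)).clm_apply continuous_const

theorem tsupport_fderiv_dir {n : ℕ} (η : Cyl n → ℝ) (v : Cyl n) :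
    tsupport (fun z => fderiv ℝ η z v) ⊆ tsupport η :=
  tsupport_fderiv_apply_subset ℝ v

theorem HasDistGradient.coord {n : ℕ} {G : Cyl n → EuclideanSpace ℂ (Fin (n + 1))}
    (h : LocallyIntegrableOn G (halfSpace n) volume) (i : Fin (n + 1)) :
    LocallyIntegrableOn (fun z => G z i) (halfSpace n) volume := by
  intro z hz
  obtain ⟨s, hs, hi⟩ := h z hz
  exact ⟨s, hs, (EuclideanSpace.proj (𝕜 := ℂ) i).integrable_comp hi⟩

theorem HasDistGradient.add {n : ℕ} {φ ψ : Cyl n → ℂ}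
    {G H : Cyl n → EuclideanSpace ℂ (Fin (n + 1))}
    (h : HasDistGradient φ G) (k : HasDistGradient ψ H) : HasDistGradient (φ + ψ) (G + H) := by
  refine ⟨h.1.add k.1, h.2.1.add k.2.1, fun η h1 h2 h3 i => ?_⟩
  have e1 := h.2.2 η h1 h2 h3 i
  have e2 := k.2.2 η h1 h2 h3 i
  have c := continuous_fderiv_dir h1 (coordDir n i)
  have s := tsupport_fderiv_dir η (coordDir n i)
  have hc : HasCompactSupport (fun z => fderiv ℝ η z (coordDir n i)) :=
    h2.mono' ((subset_tsupport _).trans s)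
  simp only [Pi.add_apply, smul_add, PiLp.add_apply]
  rw [integral_add (integrable_mul_of_test h.1 c hc (s.trans h3))
      (integrable_mul_of_test k.1 c hc (s.trans h3)),
    integral_add (integrable_mul_of_test (HasDistGradient.coord h.2.1 i) h1.continuous h2 h3)
      (integrable_mul_of_test (HasDistGradient.coord k.2.1 i) h1.continuous h2 h3), e1, e2]
  ring

theorem HasDistGradient.smul {n : ℕ} {φ : Cyl n → ℂ}
    {G : Cyl n → EuclideanSpace ℂ (Fin (n + 1))} (c : ℂ)
    (h : HasDistGradient φ G) : HasDistGradient (c • φ) (c • G) := by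
  refine ⟨h.1.smul c, h.2.1.smul c, fun η h1 h2 h3 i => ?_⟩
  have e1 := h.2.2 η h1 h2 h3 i
  simp only [Pi.smul_apply, PiLp.smul_apply]
  simp_rw [smul_comm _ c]
  rw [integral_smul, integral_smul, e1, smul_neg]

theorem HasDistGradient.zero (n : ℕ) :
    HasDistGradient (0 : Cyl n → ℂ) (0 : Cyl n → EuclideanSpace ℂ (Fin (n + 1))) := by
  refine ⟨locallyIntegrableOn_zero, locallyIntegrableOn_zero, fun η _ _ _ i => ?_⟩
  simp

theorem MemH1.add {m : ℝ} {n : ℕ} {φ ψ : Cyl n → ℂ} (h : MemH1 m n φ) (k : MemH1 m n ψ) :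
    MemH1 m n (φ + ψ) := by
  obtain ⟨⟨G, hG, hG2⟩, hφ⟩ := h
  obtain ⟨⟨H, hH, hH2⟩, hψ⟩ := k
  refine ⟨⟨G + H, hG.add hH, hG2.add hH2⟩, fun ε hε => ?_⟩
  refine lt_of_le_of_lt (measure_mono ?_)
    (measure_union_lt_top (hφ (ε / 2) (half_pos hε)) (hψ (ε / 2) (half_pos hε)))
  intro z hz
  by_contra hcon
  simp only [Set.mem_union, Set.mem_ofPred_eq, not_or, not_lt, Pi.add_apply] at hcon hz
  have := norm_add_le (φ z) (ψ z)
  linarith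

theorem MemH1.smul {m : ℝ} {n : ℕ} {φ : Cyl n → ℂ} (c : ℂ) (h : MemH1 m n φ) :
    MemH1 m n (c • φ) := by
  obtain ⟨⟨G, hG, hG2⟩, hφ⟩ := h
  refine ⟨⟨c • G, hG.smul c, hG2.const_smul c⟩, fun ε hε => ?_⟩
  have hpos : 0 < ‖c‖ + 1 := by positivity
  refine lt_of_le_of_lt (measure_mono ?_) (hφ (ε / (‖c‖ + 1)) (div_pos hε hpos))
  intro z hz
  simp only [Set.mem_ofPred_eq, Pi.smul_apply, norm_smul] at hz ⊢
  rw [div_lt_iff₀ hpos]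
  nlinarith [norm_nonneg (φ z)]

/-- The space `Ḣ¹_ℂ(ℝ₊ × ℝⁿ, ω_m ρ^{m-1} dρ dx)`. Its elements are functions, not classes of
functions; two of them represent the same element when they agree `Λ`-almost everywhere. -/
def H1 (m : ℝ) (n : ℕ) : Submodule ℂ (Cyl n → ℂ) where
  carrier := {φ | MemH1 m n φ}
  zero_mem' := ⟨⟨0, HasDistGradient.zero n, MemLp.zero⟩, fun ε hε => by
    simp [not_lt.2 hε.le]⟩
  add_mem' := fun h k => h.add k
  smul_mem' := fun c _ h => h.smul c

/-- The distributional gradient `(φ_ρ, ∇ₓ φ)` of `φ ∈ Ḣ¹_ℂ` (unique up to null sets of `ρ > 0`). -/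
def distGrad {m : ℝ} {n : ℕ} (φ : H1 m n) : Cyl n → EuclideanSpace ℂ (Fin (n + 1)) :=
  φ.2.1.choose

/-- `‖φ‖_{Ḣ¹} = (∫ (|φ_ρ|² + |∇ₓ φ|²) dΛ)^{1/2}`. -/
def h1Norm {m : ℝ} {n : ℕ} (φ : H1 m n) : ℝ :=
  (eLpNorm (distGrad φ) 2 (Lam m n)).toReal

/-- Weak convergence in `Ḣ¹_ℂ`: convergence under every linear functional that is bounded for the
norm of `Ḣ¹_ℂ`. -/
def WeakConv {m : ℝ} {n : ℕ} (u : ℕ → H1 m n) (v : H1 m n) : Prop :=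
  ∀ L : H1 m n →ₗ[ℂ] ℂ, (∃ C : ℝ, ∀ w : H1 m n, ‖L w‖ ≤ C * h1Norm w) →
    Tendsto (fun j => L (u j)) atTop (𝓝 (L v))

theorem measurableSet_halfSpace (n : ℕ) : MeasurableSet (halfSpace n) :=
  measurableSet_lt measurable_const measurable_fst

/-- The shift `(ρ, x) ↦ (ρ, x + a)`. -/
def shift {n : ℕ} (a : EuclideanSpace ℝ (Fin n)) (z : Cyl n) : Cyl n := (z.1, z.2 + a)

theorem shift_eq {n : ℕ} (a : EuclideanSpace ℝ (Fin n)) :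
    (shift a : Cyl n → Cyl n) = fun z => z + (0, a) := by
  funext z
  ext <;> simp [shift]

theorem measurePreserving_shift {n : ℕ} (a : EuclideanSpace ℝ (Fin n)) :
    MeasurePreserving (shift a : Cyl n → Cyl n) volume volume := by
  exact (MeasurePreserving.id volume).prod (measurePreserving_add_right volume a)

theorem measurableEmbedding_shift {n : ℕ} (a : EuclideanSpace ℝ (Fin n)) :
    MeasurableEmbedding (shift a : Cyl n → Cyl n) := by
  rw [shift_eq]
  exact measurableEmbedding_addRight _

theorem measurePreserving_shift_halfSpace {n : ℕ} (a : EuclideanSpace ℝ (Fin n)) :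
    MeasurePreserving (shift a : Cyl n → Cyl n) (volume.restrict (halfSpace n))
      (volume.restrict (halfSpace n)) :=
  (measurePreserving_shift a).restrict_preimage (measurableSet_halfSpace n)

theorem measurePreserving_shift_Lam (m : ℝ) {n : ℕ} (a : EuclideanSpace ℝ (Fin n)) :
    MeasurePreserving (shift a : Cyl n → Cyl n) (Lam m n) (Lam m n) := by
  have h := measurePreserving_shift_halfSpace a
  have hm : Measurable (fun z : Cyl n => ENNReal.ofReal (sphereArea m * z.1 ^ (m - 1))) := by
    fun_prop
  refine ⟨h.measurable, ?_⟩
  ext s hs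
  rw [Measure.map_apply h.measurable hs, Lam, withDensity_apply _ (h.measurable hs),
    withDensity_apply _ hs]
  exact h.setLIntegral_comp_preimage hs hm

theorem locallyIntegrableOn_shift {n : ℕ} {F : Type*} [NormedAddCommGroup F]
    {f : Cyl n → F} (hf : LocallyIntegrableOn f (halfSpace n) volume)
    (a : EuclideanSpace ℝ (Fin n)) :
    LocallyIntegrableOn (fun z => f (shift a z)) (halfSpace n) volume := by
  intro z hz
  obtain ⟨s, hs, hi⟩ := hf (shift a z) hz
  have hc : Continuous (shift a : Cyl n → Cyl n) := by
    rw [shift_eq]; fun_prop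
  refine ⟨shift a ⁻¹' s, ?_, ?_⟩
  · exact (hc.continuousWithinAt.tendsto_nhdsWithin (fun w hw => hw)) hs
  · exact ((measurePreserving_shift a).integrableOn_comp_preimage
      (measurableEmbedding_shift a)).2 hi

theorem HasDistGradient.translate {n : ℕ} {φ : Cyl n → ℂ}
    {G : Cyl n → EuclideanSpace ℂ (Fin (n + 1))} (h : HasDistGradient φ G)
    (a : EuclideanSpace ℝ (Fin n)) :
    HasDistGradient (fun z => φ (shift a z)) (fun z => G (shift a z)) := by
  refine ⟨locallyIntegrableOn_shift h.1 a, locallyIntegrableOn_shift h.2.1 a,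
    fun η h1 h2 h3 i => ?_⟩
  have hinv : ∀ z : Cyl n, shift a z + (0, -a) = z := by
    intro z; ext <;> simp [shift]
  have hhom : Topology.IsClosedEmbedding (fun z : Cyl n => z + (0, -a)) :=
    (Homeomorph.addRight ((0, -a) : Cyl n)).isClosedEmbedding
  have e := h.2.2 (fun z => η (z + (0, -a))) (h1.comp (contDiff_id.add contDiff_const))
    (h2.comp_isClosedEmbedding hhom)
    (by
      intro z hz
      have := h3 (tsupport_comp_subset_preimage η hhom.continuous hz)
      simpa [halfSpace] using this) i
  have key := measurePreserving_shift_halfSpace (n := n) a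
  rw [← key.integral_comp (measurableEmbedding_shift a)
      (fun z => fderiv ℝ (fun z => η (z + (0, -a))) z (coordDir n i) • φ z),
    ← key.integral_comp (measurableEmbedding_shift a)
      (fun z => η (z + (0, -a)) • G z i)] at e
  simpa only [fderiv_comp_add_right, hinv] using e

theorem MemH1.translate {m : ℝ} {n : ℕ} {φ : Cyl n → ℂ} (h : MemH1 m n φ)
    (a : EuclideanSpace ℝ (Fin n)) : MemH1 m n (fun z => φ (shift a z)) := by
  obtain ⟨⟨G, hG, hG2⟩, hφ⟩ := h
  have key := measurePreserving_shift_Lam m (n := n) a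
  refine ⟨⟨_, hG.translate a, hG2.comp_measurePreserving key⟩, fun ε hε => ?_⟩
  have := key.measure_preimage_emb (measurableEmbedding_shift a) {z | ε < ‖φ z‖}
  exact lt_of_eq_of_lt this (hφ ε hε)

/-- The translate `(ρ, x) ↦ φ(ρ, x + a)` of `φ ∈ Ḣ¹_ℂ`. -/
def translate {m : ℝ} {n : ℕ} (a : EuclideanSpace ℝ (Fin n)) (φ : H1 m n) : H1 m n :=
  ⟨fun z => (φ : Cyl n → ℂ) (z.1, z.2 + a), MemH1.translate φ.2 a⟩

end CylSobolev

end

open scoped ENNReal NNReal Convolution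

noncomputable section

namespace CylSobolev

/-! The argument works with averages over boxes and needs neither a Sobolev embedding nor Rellich
compactness. Cut the half-space into tiles of side `l`. If every tile meeting `E = {|φ| > ε, ρ ≤ R}`
had an average of modulus at most `ε/2`, then `φ` would differ from its tile average by more than
`ε/2` on `E`. Chebyshev and the Poincaré inequality, summed over tiles, would give `(ε/2)² Λ(E) ≤ P
l² ‖φ‖²`, which is false for small `l` because `Λ(E) ≥ δ`. So each `φ_j` has a tile with a large
average, in one of finitely many layers since `ρ ≤ R` (`exists_lt_norm_boxAvg`). Translate its
corner to `x = 0`. A box average is a bounded functional on `Ḣ¹`, so a weak limit of the translates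
keeps a large average in one of these layers and cannot vanish.

Three facts carry this. The Poincaré inequality on convex sets (`HasDistGradient.lintegral_sub_le`)
is proved by integrating the gradient of a mollification along segments; the weight does no harm
because at least one endpoint of a segment enters with coefficient at least `1/2`. The bound on
averages (`HasDistGradient.norm_boxAvg_le`) telescopes over doubled boxes: the differences decay
geometrically because `m + n > 2`, and finiteness of the sets `{|φ| > ε}` makes the averages tend to
`0`. Weak compactness (`exists_subseq_weakConv`) holds because the gradients form a closed subspace
of `L²(Λ)` (`isClosed_range_gradLp`): by the two previous facts the gradient norm controls `L²` on
every box, so limits of gradients come from limits of functions. -/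

instance isAddHaarMeasure_volume (n : ℕ) : (volume : Measure (Cyl n)).IsAddHaarMeasure :=
  inferInstanceAs ((volume : Measure ℝ).prod
    (volume : Measure (EuclideanSpace ℝ (Fin n)))).IsAddHaarMeasure

instance sigmaFinite_Lam (m : ℝ) (n : ℕ) : SigmaFinite (Lam m n) := by
  unfold Lam
  infer_instance

theorem isOpen_halfSpace (n : ℕ) : IsOpen (halfSpace n) :=
  isOpen_lt continuous_const continuous_fst

theorem finrank_Cyl (n : ℕ) : Module.finrank ℝ (Cyl n) = n + 1 := by
  simp [Module.finrank_prod, add_comm]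

theorem sphereArea_pos {m : ℝ} (hm : 1 ≤ m) : 0 < sphereArea m := by
  have : 0 < Real.Gamma (m / 2) := Real.Gamma_pos_of_pos (by linarith)
  unfold sphereArea
  positivity

/-! ### The weight and affine changes of variables -/

/-- The density `ω_m ρ^{m-1}` of `Λ`. -/
def weight (m : ℝ) (n : ℕ) (z : Cyl n) : ℝ≥0∞ := ENNReal.ofReal (sphereArea m * z.1 ^ (m - 1))

theorem measurable_weight (m : ℝ) (n : ℕ) : Measurable (weight m n) := by
  unfold weight
  fun_prop

theorem Lam_absolutelyContinuous (m : ℝ) (n : ℕ) :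
    Lam m n ≪ volume.restrict (halfSpace n) :=
  withDensity_absolutelyContinuous _ _

theorem setLIntegral_Lam (m : ℝ) {n : ℕ} {s : Set (Cyl n)} (hs : MeasurableSet s)
    (hsH : s ⊆ halfSpace n) {f : Cyl n → ℝ≥0∞} (hf : Measurable f) :
    ∫⁻ z in s, f z ∂(Lam m n) = ∫⁻ z in s, weight m n z * f z := by
  have := setLIntegral_withDensity_eq_setLIntegral_mul (volume.restrict (halfSpace n))
    (measurable_weight m n) hf hs
  rw [Measure.restrict_restrict hs, Set.inter_eq_self_of_subset_left hsH] at this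
  exact this

theorem Lam_apply (m : ℝ) {n : ℕ} {s : Set (Cyl n)} (hs : MeasurableSet s)
    (hsH : s ⊆ halfSpace n) : Lam m n s = ∫⁻ z in s, weight m n z := by
  have := setLIntegral_Lam m hs hsH (f := fun _ => 1) measurable_const
  simpa using this

/-- Since `m - 1 ≥ 0`, a one-sided comparison of heights already compares densities, even where the
density degenerates at `ρ = 0`. -/
theorem weight_le_mul {m : ℝ} {n : ℕ} (hm : 1 ≤ m) {z w : Cyl n} {c : ℝ} (hc : 0 ≤ c)
    (hz : 0 ≤ z.1) (hw : 0 ≤ w.1) (h : z.1 ≤ c * w.1) :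
    weight m n z ≤ ENNReal.ofReal (c ^ (m - 1)) * weight m n w := by
  have := (sphereArea_pos hm).le
  unfold weight
  rw [← ENNReal.ofReal_mul (by positivity)]
  refine ENNReal.ofReal_le_ofReal ?_
  calc sphereArea m * z.1 ^ (m - 1) ≤ sphereArea m * (c * w.1) ^ (m - 1) := by
        gcongr
    _ = _ := by rw [Real.mul_rpow hc hw]; ring

/-- Cauchy–Schwarz against the constant `1`. -/
theorem sq_lintegral_le {α : Type*} [MeasurableSpace α] (μ : Measure α) {f : α → ℝ≥0∞}
    (hf : AEMeasurable f μ) : (∫⁻ a, f a ∂μ) ^ 2 ≤ μ Set.univ * ∫⁻ a, f a ^ 2 ∂μ := by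
  have h := ENNReal.lintegral_mul_le_Lp_mul_Lq μ Real.HolderConjugate.two_two
    (aemeasurable_const (b := (1 : ℝ≥0∞))) hf
  simp only [Pi.mul_apply, one_mul, ENNReal.one_rpow, lintegral_const] at h
  calc (∫⁻ a, f a ∂μ) ^ 2 ≤ _ := pow_le_pow_left' h 2
    _ = _ := by
      rw [mul_pow, ← ENNReal.rpow_natCast, ← ENNReal.rpow_natCast, ← ENNReal.rpow_mul,
        ← ENNReal.rpow_mul]
      simp

theorem ae_prod_of_ae_fst {α β : Type*} [MeasurableSpace α] [MeasurableSpace β] {μ : Measure α}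
    {ν : Measure β} {p : α → Prop} (h : ∀ᵐ a ∂μ, p a) : ∀ᵐ q ∂(μ.prod ν), p q.1 :=
  (Measure.quasiMeasurePreserving_fst (μ := μ) (ν := ν)).ae h

theorem ae_prod_of_ae_snd {α β : Type*} [MeasurableSpace α] [MeasurableSpace β] {μ : Measure α}
    {ν : Measure β} [SFinite ν] {p : β → Prop} (h : ∀ᵐ b ∂ν, p b) : ∀ᵐ q ∂(μ.prod ν), p q.2 :=
  (Measure.quasiMeasurePreserving_snd (μ := μ) (ν := ν)).ae h

/-- The Jacobian factor is `c^{-(n+1)}`, at most `2^(n+1)` when `c ≥ 1/2`. -/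
theorem lintegral_comp_smul_add {n : ℕ} {h : Cyl n → ℝ≥0∞} (hh : Measurable h) {c : ℝ}
    (hc : 1 / 2 ≤ c) (b : Cyl n) :
    ∫⁻ z, h (c • z + b) ≤ 2 ^ (n + 1) * ∫⁻ z, h z := by
  have hc0 : c ≠ 0 := by linarith
  have h1 : ∫⁻ z, h (c • z + b) = ∫⁻ z, h (z + b) ∂(Measure.map (fun x => c • x) volume) := by
    rw [lintegral_map (by fun_prop) (by fun_prop)]
  rw [h1, Measure.map_addHaar_smul _ hc0, lintegral_smul_measure, lintegral_add_right_eq_self,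
    finrank_Cyl, smul_eq_mul]
  gcongr
  rw [abs_of_nonneg (by positivity), show (2 : ℝ≥0∞) ^ (n + 1) = ENNReal.ofReal (2 ^ (n + 1)) by
    rw [ENNReal.ofReal_pow (by norm_num)]; simp]
  refine ENNReal.ofReal_le_ofReal ?_
  rw [← inv_pow]
  refine pow_le_pow_left₀ (by positivity) ?_ _
  rw [inv_le_comm₀ (by linarith) (by norm_num)]
  linarith

/-- One variable of the segment change of variables. -/
theorem setLIntegral_comp_smul_add_Lam_le {m : ℝ} {n : ℕ} (hm : 1 ≤ m) {s : Set (Cyl n)}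
    (hs : MeasurableSet s) (hsH : s ⊆ halfSpace n) {h : Cyl n → ℝ≥0∞} (hh : Measurable h) {c : ℝ}
    (hc : 1 / 2 ≤ c) {b : Cyl n}
    (hb : ∀ z ∈ s, c • z + b ∈ halfSpace n ∧ z.1 ≤ 4 * (c • z + b).1) :
    ∫⁻ z in s, h (c • z + b) ∂(Lam m n) ≤
      ENNReal.ofReal (4 ^ (m - 1)) * 2 ^ (n + 1) * ∫⁻ z, h z ∂(Lam m n) := by
  have hH := measurableSet_halfSpace n
  have hW := measurable_weight m n
  rw [setLIntegral_Lam m hs hsH (by fun_prop)]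
  have e : ∫⁻ z, h z ∂(Lam m n) = ∫⁻ z, (halfSpace n).indicator (fun z => weight m n z * h z) z := by
    rw [lintegral_indicator hH, ← setLIntegral_Lam m hH subset_rfl hh]
    conv_rhs => rw [Lam, restrict_withDensity hH, Measure.restrict_restrict hH, Set.inter_self]
    rfl
  rw [e]
  calc ∫⁻ z in s, weight m n z * h (c • z + b)
      ≤ ∫⁻ z in s, ENNReal.ofReal (4 ^ (m - 1)) *
          (halfSpace n).indicator (fun z => weight m n z * h z) (c • z + b) := by
        refine setLIntegral_mono' hs fun z hz => ?_
        obtain ⟨h1, h2⟩ := hb z hz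
        rw [Set.indicator_of_mem h1, ← mul_assoc]
        gcongr
        exact weight_le_mul hm (by norm_num) (le_of_lt (hsH hz)) (le_of_lt h1) h2
    _ ≤ ∫⁻ z, ENNReal.ofReal (4 ^ (m - 1)) *
          (halfSpace n).indicator (fun z => weight m n z * h z) (c • z + b) :=
        setLIntegral_le_lintegral _ _
    _ ≤ _ := by
        have hmeas : Measurable ((halfSpace n).indicator (fun z => weight m n z * h z)) :=
          (hW.mul hh).indicator hH
        rw [lintegral_const_mul _ (by fun_prop), mul_assoc]
        gcongr
        exact lintegral_comp_smul_add hmeas hc b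

/-! ### Directional derivatives and differences of mollifications -/

/-- The coordinates of a vector in the basis `coordDir`. -/
def dirCoord {n : ℕ} (v : Cyl n) (i : Fin (n + 1)) : ℝ := Fin.cases v.1 (fun k => v.2 k) i

theorem sum_dirCoord {n : ℕ} (v : Cyl n) : ∑ i, dirCoord v i • coordDir n i = v := by
  rw [Fin.sum_univ_succ]
  ext j
  · simp [dirCoord, coordDir, Prod.fst_sum]
  · simp [dirCoord, coordDir, Prod.snd_sum, Pi.single_apply]

theorem abs_dirCoord_le {n : ℕ} (v : Cyl n) (i : Fin (n + 1)) : |dirCoord v i| ≤ ‖v‖ := by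
  refine Fin.cases ?_ (fun k => ?_) i
  · exact norm_fst_le v
  · exact (PiLp.norm_apply_le v.2 k).trans (norm_snd_le v)

/-- The directional derivative `g · v` for a gradient `g`. -/
def dirDeriv {n : ℕ} (v : Cyl n) (g : EuclideanSpace ℂ (Fin (n + 1))) : ℂ :=
  ∑ i, dirCoord v i • g i

theorem norm_dirDeriv_le {n : ℕ} (v : Cyl n) (g : EuclideanSpace ℂ (Fin (n + 1))) :
    ‖dirDeriv v g‖ ≤ (n + 1) * ‖v‖ * ‖g‖ := by
  calc ‖dirDeriv v g‖ ≤ ∑ i, ‖dirCoord v i • g i‖ := norm_sum_le _ _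
    _ ≤ ∑ _i : Fin (n + 1), ‖v‖ * ‖g‖ := by
        refine Finset.sum_le_sum fun i _ => ?_
        rw [norm_smul]
        exact mul_le_mul (abs_dirCoord_le v i) (PiLp.norm_apply_le g i) (norm_nonneg _)
          (norm_nonneg _)
    _ = _ := by simp; ring

/-- The regularization of `φ` by a normalized bump. -/
def mollify {n : ℕ} (f : ContDiffBump (0 : Cyl n)) (φ : Cyl n → ℂ) (z : Cyl n) : ℂ :=
  ∫ y in halfSpace n, f.normed volume (z - y) • φ y

theorem mem_halfSpace_of_dist_le {n : ℕ} {p y : Cyl n} {r : ℝ} (h : dist y p ≤ r)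
    (hp : r < p.1) : y ∈ halfSpace n := by
  have h1 : dist y.1 p.1 ≤ r := (le_max_left _ _).trans h
  rw [Real.dist_eq, abs_le] at h1
  change 0 < y.1
  linarith [h1.1]

section reflected

variable {n : ℕ} (f : ContDiffBump (0 : Cyl n))

theorem contDiff_reflected (p : Cyl n) : ContDiff ℝ ∞ (fun y => f.normed volume (p - y)) :=
  f.contDiff_normed.comp (contDiff_const.sub contDiff_id)

theorem tsupport_reflected (p : Cyl n) :
    tsupport (fun y => f.normed volume (p - y)) ⊆ Metric.closedBall p f.rOut := by
  refine closure_minimal ?_ Metric.isClosed_closedBall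
  intro y hy
  have : p - y ∈ Function.support (f.normed volume) := hy
  rw [f.support_normed_eq, mem_ball_zero_iff] at this
  rw [Metric.mem_closedBall, dist_comm, dist_eq_norm]
  exact this.le

theorem hasCompactSupport_reflected (p : Cyl n) :
    HasCompactSupport (fun y => f.normed volume (p - y)) :=
  (isCompact_closedBall p f.rOut).of_isClosed_subset (isClosed_tsupport _)
    (tsupport_reflected f p)

theorem tsupport_reflected_subset_halfSpace {p : Cyl n} (hp : f.rOut < p.1) :
    tsupport (fun y => f.normed volume (p - y)) ⊆ halfSpace n :=
  (tsupport_reflected f p).trans fun _ hy => mem_halfSpace_of_dist_le hy hp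

theorem fderiv_reflected (p y v : Cyl n) :
    fderiv ℝ (fun y => f.normed volume (p - y)) y v = -fderiv ℝ (f.normed volume) (p - y) v := by
  have h : DifferentiableAt ℝ (f.normed volume) (p - y) :=
    (f.contDiff_normed (n := 1)).differentiable (by simp) _
  have h2 : HasFDerivAt (fun y : Cyl n => p - y) (-ContinuousLinearMap.id ℝ (Cyl n)) y := by
    simpa using (hasFDerivAt_id y).const_sub p
  have := (h.hasFDerivAt.comp y h2).fderiv
  change fderiv ℝ (f.normed volume ∘ fun y => p - y) y v = _
  rw [this]
  simp

/-- The reflected bump `y ↦ f(p - y)` is an admissible test function when `p` lies higher than the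
bump radius; the sign from the reflection cancels the sign of integration by parts. -/
theorem HasDistGradient.integral_fderiv_normed {φ : Cyl n → ℂ}
    {G : Cyl n → EuclideanSpace ℂ (Fin (n + 1))} (h : HasDistGradient φ G) {p : Cyl n}
    (hp : f.rOut < p.1) (v : Cyl n) :
    ∫ y in halfSpace n, fderiv ℝ (f.normed volume) (p - y) v • φ y =
      ∫ y in halfSpace n, f.normed volume (p - y) • dirDeriv v (G y) := by
  have c1 := contDiff_reflected f p
  have c2 := hasCompactSupport_reflected f p
  have c3 := tsupport_reflected_subset_halfSpace f hp
  have key := h.2.2 _ c1 c2 c3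
  have e : ∀ i, ∫ y in halfSpace n, fderiv ℝ (f.normed volume) (p - y) (coordDir n i) • φ y =
      ∫ y in halfSpace n, f.normed volume (p - y) • G y i := by
    intro i
    have := key i
    simp only [fderiv_reflected, neg_smul, integral_neg, neg_inj] at this
    exact this
  have i1 : ∀ i, IntegrableOn (fun y => fderiv ℝ (f.normed volume) (p - y) (coordDir n i) • φ y)
      (halfSpace n) volume := by
    intro i
    have s := tsupport_fderiv_dir (fun y => f.normed volume (p - y)) (coordDir n i)
    have := integrable_mul_of_test h.1 (continuous_fderiv_dir c1 (coordDir n i))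
      (c2.mono' ((subset_tsupport _).trans s)) (s.trans c3)
    simp only [fderiv_reflected, neg_smul] at this
    exact integrable_neg_iff.1 this
  have i2 : ∀ i, IntegrableOn (fun y => f.normed volume (p - y) • G y i)
      (halfSpace n) volume := fun i =>
    integrable_mul_of_test (HasDistGradient.coord h.2.1 i) c1.continuous c2 c3
  calc ∫ y in halfSpace n, fderiv ℝ (f.normed volume) (p - y) v • φ y
      = ∫ y in halfSpace n, ∑ i, dirCoord v i •
          (fderiv ℝ (f.normed volume) (p - y) (coordDir n i) • φ y) := by
        congr 1
        ext y
        conv_lhs => rw [← sum_dirCoord v]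
        simp [map_sum, Finset.sum_mul, mul_assoc]
    _ = ∑ i, dirCoord v i • ∫ y in halfSpace n,
          fderiv ℝ (f.normed volume) (p - y) (coordDir n i) • φ y := by
        rw [integral_finsetSum _ fun i _ => Integrable.fun_smul (dirCoord v i) (i1 i)]
        simp_rw [integral_smul]
    _ = ∑ i, dirCoord v i • ∫ y in halfSpace n, f.normed volume (p - y) • G y i := by
        simp_rw [e]
    _ = _ := by
        simp_rw [← integral_smul]
        rw [← integral_finsetSum _ fun i _ => Integrable.fun_smul (dirCoord v i) (i2 i)]
        congr 1
        ext y
        simp only [dirDeriv, Finset.smul_sum]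
        exact Finset.sum_congr rfl fun i _ => smul_comm _ _ _

/-- The fundamental theorem of calculus is applied to the kernel, so the mollification itself never
has to be differentiated under the integral. -/
theorem normed_sub_normed (z w y : Cyl n) :
    f.normed volume (w - y) - f.normed volume (z - y) =
      ∫ t in Set.Ioc (0 : ℝ) 1,
        fderiv ℝ (f.normed volume) ((1 - t) • z + t • w - y) (w - z) := by
  have hd : Differentiable ℝ (f.normed volume) :=
    (f.contDiff_normed (n := 1)).differentiable (by simp)
  have hc : Continuous (fun t : ℝ =>
      fderiv ℝ (f.normed volume) ((1 - t) • z + t • w - y) (w - z)) := by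
    have := continuous_fderiv_dir (f.contDiff_normed (μ := (volume : Measure (Cyl n)))) (w - z)
    exact this.comp (by fun_prop)
  have h1 : ∀ t : ℝ, HasDerivAt (fun t : ℝ => f.normed volume ((1 - t) • z + t • w - y))
      (fderiv ℝ (f.normed volume) ((1 - t) • z + t • w - y) (w - z)) t := by
    intro t
    have h2 : HasDerivAt (fun t : ℝ => (1 - t) • z + t • w - y) (w - z) t := by
      have := ((((hasDerivAt_id t).const_sub 1).smul_const z).add
        ((hasDerivAt_id t).smul_const w)).sub_const y
      have e : (-1 : ℝ) • z + (1 : ℝ) • w = w - z := by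
        rw [neg_smul, one_smul, one_smul, neg_add_eq_sub]
      rw [e] at this
      exact this
    exact (hd _).hasFDerivAt.comp_hasDerivAt t h2
  rw [← intervalIntegral.integral_of_le zero_le_one,
    intervalIntegral.integral_eq_sub_of_hasDerivAt (fun t _ => h1 t) (hc.intervalIntegrable _ _)]
  simp

theorem fst_segment_gt {z w : Cyl n} {r : ℝ} (hz : r < z.1) (hw : r < w.1) {t : ℝ}
    (ht : t ∈ Set.Icc (0 : ℝ) 1) : r < ((1 - t) • z + t • w).1 := by
  have := (convex_Ioi r) (x := z.1) hz (y := w.1) hw (a := 1 - t) (b := t) (by linarith [ht.2]) ht.1 (by ring)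
  simpa using this

theorem HasDistGradient.mollify_sub {φ : Cyl n → ℂ}
    {G : Cyl n → EuclideanSpace ℂ (Fin (n + 1))} (h : HasDistGradient φ G) {z w : Cyl n}
    (hz : f.rOut < z.1) (hw : f.rOut < w.1) :
    mollify f φ w - mollify f φ z =
      ∫ t in Set.Ioc (0 : ℝ) 1, ∫ y in halfSpace n,
        f.normed volume ((1 - t) • z + t • w - y) • dirDeriv (w - z) (G y) := by
  have hcont := continuous_fderiv_dir (f.contDiff_normed (μ := (volume : Measure (Cyl n)))) (w - z)
  have hcs : HasCompactSupport (fun y => fderiv ℝ (f.normed volume) y (w - z)) :=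
    (f.hasCompactSupport_normed (μ := (volume : Measure (Cyl n)))).mono'
      ((subset_tsupport _).trans (tsupport_fderiv_dir _ _))
  obtain ⟨C, hC⟩ := hcs.exists_bound_of_continuous hcont
  have hint : ∀ p : Cyl n, f.rOut < p.1 →
      IntegrableOn (fun y => f.normed volume (p - y) • φ y) (halfSpace n) volume := fun p hp =>
    integrable_mul_of_test h.1 (contDiff_reflected f p).continuous
      (hasCompactSupport_reflected f p) (tsupport_reflected_subset_halfSpace f hp)
  -- All kernels along the segment live in one compact neighbourhood `K` of it inside the
  -- half-space, where `φ` is integrable; this gives the dominating function for Fubini.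
  set S : Set (Cyl n) := (fun t : ℝ => (1 - t) • z + t • w) '' Set.Icc 0 1 with hS
  have hSc : IsCompact S := isCompact_Icc.image (by fun_prop)
  set K := Metric.cthickening f.rOut S with hK
  have hKc : IsCompact K := hSc.cthickening
  have hKH : K ⊆ halfSpace n := by
    rw [hK, hSc.cthickening_eq_biUnion_closedBall f.rOut_pos.le]
    intro y hy
    simp only [Set.mem_iUnion, exists_prop] at hy
    obtain ⟨_, ⟨t, ht, rfl⟩, hy⟩ := hy
    exact mem_halfSpace_of_dist_le hy (fst_segment_gt hz hw ht)
  have hφK : Integrable (K.indicator φ) (volume.restrict (halfSpace n)) :=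
    ((integrable_indicator_iff hKc.measurableSet).2
      (h.1.integrableOn_compact_subset hKH hKc)).integrableOn
  have hprod : Integrable (Function.uncurry fun (y : Cyl n) (t : ℝ) =>
      fderiv ℝ (f.normed volume) ((1 - t) • z + t • w - y) (w - z) • φ y)
      ((volume.restrict (halfSpace n)).prod (volume.restrict (Set.Ioc (0 : ℝ) 1))) := by
    have hb : Integrable (fun q : Cyl n × ℝ => C * ‖K.indicator φ q.1‖)
        ((volume.restrict (halfSpace n)).prod (volume.restrict (Set.Ioc (0 : ℝ) 1))) :=
      (hφK.norm.const_mul C).comp_fst _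
    refine hb.mono' ?_ ?_
    · have h1 : Continuous (fun q : Cyl n × ℝ =>
          fderiv ℝ (f.normed volume) ((1 - q.2) • z + q.2 • w - q.1) (w - z)) :=
        hcont.comp (by fun_prop)
      have h2 : AEStronglyMeasurable (fun q : Cyl n × ℝ => φ q.1)
          ((volume.restrict (halfSpace n)).prod (volume.restrict (Set.Ioc (0 : ℝ) 1))) :=
        h.1.aestronglyMeasurable.comp_fst
      exact h1.aestronglyMeasurable.smul h2
    · have : ∀ᵐ q ∂((volume.restrict (halfSpace n)).prod (volume.restrict (Set.Ioc (0 : ℝ) 1))),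
          q.2 ∈ Set.Ioc (0 : ℝ) 1 :=
        ae_prod_of_ae_snd (ae_restrict_mem measurableSet_Ioc)
      filter_upwards [this] with q hq
      obtain ⟨y, t⟩ := q
      simp only [Function.uncurry_apply_pair, norm_smul]
      by_cases hy : y ∈ K
      · rw [Set.indicator_of_mem hy]
        gcongr
        exact hC _
      · have : fderiv ℝ (f.normed volume) ((1 - t) • z + t • w - y) (w - z) = 0 := by
          by_contra hne
          apply hy
          have h1 := tsupport_fderiv_dir (f.normed volume) (w - z) (subset_tsupport _ hne)
          rw [f.tsupport_normed_eq, mem_closedBall_zero_iff] at h1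
          refine Metric.mem_cthickening_of_dist_le y ((1 - t) • z + t • w) _ _
            ⟨t, Set.Ioc_subset_Icc_self hq, rfl⟩ ?_
          rwa [dist_comm, dist_eq_norm]
        rw [this, Set.indicator_of_notMem hy]
        simp
  calc mollify f φ w - mollify f φ z
      = ∫ y in halfSpace n, (f.normed volume (w - y) - f.normed volume (z - y)) • φ y := by
        rw [mollify, mollify, ← integral_sub (hint w hw) (hint z hz)]
        simp_rw [sub_smul]
    _ = ∫ y in halfSpace n, ∫ t in Set.Ioc (0 : ℝ) 1,
          fderiv ℝ (f.normed volume) ((1 - t) • z + t • w - y) (w - z) • φ y := by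
        simp_rw [normed_sub_normed f z w, integral_smul_const]
    _ = ∫ t in Set.Ioc (0 : ℝ) 1, ∫ y in halfSpace n,
          fderiv ℝ (f.normed volume) ((1 - t) • z + t • w - y) (w - z) • φ y :=
        integral_integral_swap hprod
    _ = _ := by
        refine setIntegral_congr_fun measurableSet_Ioc fun t ht => ?_
        exact h.integral_fderiv_normed f
          (fst_segment_gt hz hw (Set.Ioc_subset_Icc_self ht)) (w - z)

end reflected

/-! ### The Poincaré inequality for mollifications -/

/-- The points of `Q` at distance at least `r` from the complement. -/
def erosion {n : ℕ} (r : ℝ) (Q : Set (Cyl n)) : Set (Cyl n) := (Metric.thickening r Qᶜ)ᶜ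

theorem measurableSet_erosion {n : ℕ} (r : ℝ) (Q : Set (Cyl n)) : MeasurableSet (erosion r Q) :=
  Metric.isOpen_thickening.measurableSet.compl

theorem mem_erosion_iff {n : ℕ} {r : ℝ} {Q : Set (Cyl n)} {z : Cyl n} :
    z ∈ erosion r Q ↔ ∀ e : Cyl n, ‖e‖ < r → z + e ∈ Q := by
  simp only [erosion, Set.mem_compl_iff, Metric.mem_thickening_iff, not_exists, not_and, not_lt]
  constructor
  · intro h e he
    by_contra hc
    have := h _ hc
    rw [dist_self_add_right] at this
    linarith
  · intro h y hy
    by_contra! hc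
    apply hy
    have := h (y - z) (by rwa [dist_comm, dist_eq_norm] at hc)
    rwa [add_sub_cancel] at this

theorem erosion_subset {n : ℕ} {r : ℝ} (hr : 0 < r) (Q : Set (Cyl n)) : erosion r Q ⊆ Q := by
  intro z hz
  simpa using mem_erosion_iff.1 hz 0 (by simpa)

theorem convex_erosion {n : ℕ} {Q : Set (Cyl n)} (hQ : Convex ℝ Q) (r : ℝ) :
    Convex ℝ (erosion r Q) := by
  intro z hz w hw a b ha hb hab
  rw [mem_erosion_iff] at *
  intro e he
  have := hQ (hz e he) (hw e he) ha hb hab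
  convert this using 1
  rw [smul_add, smul_add, add_add_add_comm, ← add_smul, hab, one_smul]

/-- Otherwise a vertical move shorter than `r` would reach `ρ = 0` without leaving `Q`. -/
theorem le_fst_of_mem_erosion {n : ℕ} {Q : Set (Cyl n)} (hQ : Q ⊆ halfSpace n) {r : ℝ}
    {z : Cyl n} (hr : 0 < r) (hz : z ∈ erosion r Q) : r ≤ z.1 := by
  by_contra! hc
  have h0 : (0 : ℝ) < z.1 := hQ (erosion_subset hr Q hz)
  have h1 := mem_erosion_iff.1 hz (-z.1, 0) (by
    rw [Prod.norm_def]
    simpa [abs_of_pos h0] using ⟨hc, hr⟩)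
  have : (0 : ℝ) < (z + ((-z.1, 0) : Cyl n)).1 := hQ h1
  simp at this

section

variable {n : ℕ} (f : ContDiffBump (0 : Cyl n))

/-- The probability measure on `(t, u)`: uniform in `t ∈ (0, 1]`, bump density in `u`. -/
def segmentMeasure : Measure (ℝ × Cyl n) :=
  (volume.restrict (Set.Ioc (0 : ℝ) 1)).prod
    (volume.withDensity fun u => ENNReal.ofReal (f.normed volume u))

theorem measurable_bumpDensity :
    Measurable (fun u : Cyl n => ENNReal.ofReal (f.normed volume u)) :=
  (f.contDiff_normed (n := 0)).continuous.measurable.ennreal_ofReal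

theorem isProbabilityMeasure_bump : IsProbabilityMeasure
    ((volume : Measure (Cyl n)).withDensity fun u => ENNReal.ofReal (f.normed volume u)) := by
  constructor
  rw [withDensity_apply _ MeasurableSet.univ, Measure.restrict_univ,
    ← ofReal_integral_eq_lintegral_ofReal f.integrable_normed
      (Eventually.of_forall f.nonneg_normed), f.integral_normed, ENNReal.ofReal_one]

instance : IsProbabilityMeasure (segmentMeasure f) := by
  have := isProbabilityMeasure_bump f
  have : IsProbabilityMeasure (volume.restrict (Set.Ioc (0 : ℝ) 1)) := ⟨by simp⟩
  unfold segmentMeasure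
  infer_instance

theorem ae_segmentMeasure :
    ∀ᵐ q ∂(segmentMeasure f), q.1 ∈ Set.Ioc (0 : ℝ) 1 ∧ ‖q.2‖ < f.rOut := by
  have := isProbabilityMeasure_bump f
  have h1 : ∀ᵐ u ∂((volume : Measure (Cyl n)).withDensity
      fun u => ENNReal.ofReal (f.normed volume u)), ‖u‖ < f.rOut := by
    rw [ae_withDensity_iff (measurable_bumpDensity f)]
    refine Eventually.of_forall fun u hu => ?_
    have : u ∈ Function.support (f.normed volume) := fun h0 => hu (by simp [h0])
    rwa [f.support_normed_eq, mem_ball_zero_iff] at this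
  exact (ae_prod_of_ae_fst (ae_restrict_mem measurableSet_Ioc)).and (ae_prod_of_ae_snd h1)

/-- The substitution `u = p - y` turns the convolution at a point `p` of the segment into an average
over bump shifts `u`. Convexity of the erosion keeps every shifted segment in `Q`, so only values of
the gradient on `Q` enter. -/
theorem HasDistGradient.enorm_mollify_sub_le {φ : Cyl n → ℂ}
    {G : Cyl n → EuclideanSpace ℂ (Fin (n + 1))} (h : HasDistGradient φ G) (hG : Measurable G)
    {Q : Set (Cyl n)} (hQm : MeasurableSet Q) (hQ : Convex ℝ Q) (hQH : Q ⊆ halfSpace n)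
    {z w : Cyl n}
    (hz : z ∈ erosion (2 * f.rOut) Q) (hw : w ∈ erosion (2 * f.rOut) Q) :
    ‖mollify f φ w - mollify f φ z‖ₑ ≤ ENNReal.ofReal ((n + 1) * ‖w - z‖) *
      ∫⁻ q, Q.indicator (fun y => ‖G y‖ₑ) ((1 - q.1) • z + q.1 • w - q.2) ∂(segmentMeasure f) := by
  have hr := f.rOut_pos
  have := isProbabilityMeasure_bump f
  have hz1 := le_fst_of_mem_erosion hQH (by linarith) hz
  have hw1 := le_fst_of_mem_erosion hQH (by linarith) hw
  have hg : Measurable (Q.indicator (fun y => ‖G y‖ₑ)) := hG.enorm.indicator hQm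
  rw [h.mollify_sub f (by linarith) (by linarith), segmentMeasure,
    lintegral_prod _ (by fun_prop), ← lintegral_const_mul _ (by fun_prop)]
  refine (enorm_integral_le_lintegral_enorm _).trans
    (setLIntegral_mono' measurableSet_Ioc fun t ht => ?_)
  set p := (1 - t) • z + t • w with hp
  have hpQ : p ∈ erosion (2 * f.rOut) Q :=
    convex_erosion hQ _ hz hw (by linarith [ht.2]) ht.1.le (by ring)
  rw [lintegral_withDensity_eq_lintegral_mul _ (measurable_bumpDensity f) (by fun_prop),
    ← lintegral_const_mul _ (by
      exact (measurable_bumpDensity f).mul (by fun_prop)),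
    ← lintegral_sub_left_eq_self _ p]
  refine (enorm_integral_le_lintegral_enorm _).trans ((setLIntegral_le_lintegral _ _).trans
    (lintegral_mono fun y => ?_))
  simp only [Pi.mul_apply, ← hp, sub_sub_cancel, enorm_smul]
  by_cases hy : f.normed volume (p - y) = 0
  · simp [hy]
  · have hy' : p - y ∈ Function.support (f.normed volume) := hy
    rw [f.support_normed_eq, mem_ball_zero_iff] at hy'
    have hyQ : y ∈ Q := by
      have := mem_erosion_iff.1 hpQ (y - p) (by rw [norm_sub_rev]; linarith)
      rwa [add_sub_cancel] at this
    rw [Set.indicator_of_mem hyQ, mul_left_comm]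
    gcongr
    · rw [← ofReal_norm, Real.norm_of_nonneg (f.nonneg_normed _)]
    · rw [← ofReal_norm, ← ofReal_norm, ← ENNReal.ofReal_mul (by positivity)]
      exact ENNReal.ofReal_le_ofReal (norm_dirDeriv_le _ _)

/-- The constant in the change of variables along segments. -/
def segConst (m : ℝ) (n : ℕ) : ℝ≥0∞ := ENNReal.ofReal (4 ^ (m - 1)) * 2 ^ (n + 1)

/-- One of the coefficients `1 - t`, `t` is at least `1/2`; change variables in the corresponding
endpoint and integrate trivially in the other. Eroding by `2r` while `‖u‖ < r` keeps the shifted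
point at no less than half the height of the segment point, hence no less than a quarter of the
height of the chosen endpoint. This is the source of `4^(m-1)` in the constant. -/
theorem lintegral_segment_le {m : ℝ} (hm : 1 ≤ m) {Q : Set (Cyl n)}
    (hQ : Convex ℝ Q) (hQH : Q ⊆ halfSpace n) {g : Cyl n → ℝ≥0∞} (hg : Measurable g)
    {r : ℝ} (hr : 0 < r) {t : ℝ} (ht : t ∈ Set.Ioc (0 : ℝ) 1) {u : Cyl n} (hu : ‖u‖ < r) :
    ∫⁻ p, g ((1 - t) • p.1 + t • p.2 - u)
        ∂(((Lam m n).restrict (erosion (2 * r) Q)).prod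
          ((Lam m n).restrict (erosion (2 * r) Q))) ≤
      segConst m n * Lam m n Q * ∫⁻ z, g z ∂(Lam m n) := by
  have hmE := measurableSet_erosion (2 * r) Q
  have hEQ : erosion (2 * r) Q ⊆ Q := erosion_subset (by linarith) Q
  have hEH := hEQ.trans hQH
  have hpos : ∀ z ∈ erosion (2 * r) Q, 0 < z.1 := fun z hz => hEH hz
  have key : ∀ z ∈ erosion (2 * r) Q, ∀ w ∈ erosion (2 * r) Q,
      (1 - t) • z + t • w - u ∈ halfSpace n ∧
        ((1 - t) * z.1 + t * w.1) ≤ 2 * ((1 - t) • z + t • w - u).1 := by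
    intro z hz w hw
    have hp := convex_erosion hQ _ hz hw (by linarith [ht.2]) ht.1.le (by ring : 1 - t + t = 1)
    have h1 := le_fst_of_mem_erosion hQH (by linarith) hp
    have h2 : |u.1| < r := (norm_fst_le u).trans_lt hu
    rw [abs_lt] at h2
    simp only [Prod.fst_add, Prod.smul_fst, smul_eq_mul, Prod.fst_sub, halfSpace,
      Set.mem_ofPred_eq] at h1 ⊢
    constructor <;> linarith [h2.2]
  have hmono : ∀ c : ℝ≥0∞, ∫⁻ _ in erosion (2 * r) Q, c ∂(Lam m n) ≤ c * Lam m n Q := by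
    intro c
    rw [setLIntegral_const]
    gcongr
  rcases le_total t (1 / 2) with h | h
  · rw [lintegral_prod_symm _ (by fun_prop)]
    calc _ ≤ ∫⁻ _ in erosion (2 * r) Q, segConst m n * ∫⁻ z, g z ∂(Lam m n) ∂(Lam m n) := by
          refine setLIntegral_mono' hmE fun w hw => ?_
          simp_rw [add_sub_assoc]
          refine setLIntegral_comp_smul_add_Lam_le hm hmE hEH hg (by linarith) fun z hz => ?_
          obtain ⟨h1, h2⟩ := key z hz w hw
          rw [← add_sub_assoc]
          refine ⟨h1, ?_⟩
          nlinarith [hpos z hz, hpos w hw, ht.1]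
      _ ≤ _ := (hmono _).trans_eq (by ring)
  · rw [lintegral_prod _ (by fun_prop)]
    calc _ ≤ ∫⁻ _ in erosion (2 * r) Q, segConst m n * ∫⁻ z, g z ∂(Lam m n) ∂(Lam m n) := by
          refine setLIntegral_mono' hmE fun z hz => ?_
          simp_rw [add_comm ((1 - t) • z), add_sub_assoc]
          refine setLIntegral_comp_smul_add_Lam_le hm hmE hEH hg (by linarith) fun w hw => ?_
          obtain ⟨h1, h2⟩ := key z hz w hw
          rw [← add_sub_assoc, add_comm]
          refine ⟨h1, ?_⟩
          nlinarith [hpos z hz, hpos w hw, ht.2]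
      _ ≤ _ := (hmono _).trans_eq (by ring)

/-- Cauchy–Schwarz over the probability measure `segmentMeasure f` costs no factor. After Tonelli,
`lintegral_segment_le` applies for each fixed pair `(t, u)`, with a bound independent of the bump.
-/
theorem HasDistGradient.lintegral_mollify_sub_le {m : ℝ} (hm : 1 ≤ m) {φ : Cyl n → ℂ}
    {G : Cyl n → EuclideanSpace ℂ (Fin (n + 1))} (h : HasDistGradient φ G) (hG : Measurable G)
    {Q : Set (Cyl n)} (hQm : MeasurableSet Q) (hQ : Convex ℝ Q) (hQH : Q ⊆ halfSpace n)
    {d : ℝ} (hd : ∀ z ∈ Q, ∀ w ∈ Q, ‖w - z‖ ≤ d) :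
    ∫⁻ p, ‖mollify f φ p.2 - mollify f φ p.1‖ₑ ^ 2
        ∂(((Lam m n).restrict (erosion (2 * f.rOut) Q)).prod
          ((Lam m n).restrict (erosion (2 * f.rOut) Q))) ≤
      ENNReal.ofReal ((n + 1) * d) ^ 2 *
        (segConst m n * Lam m n Q * ∫⁻ z in Q, ‖G z‖ₑ ^ 2 ∂(Lam m n)) := by
  have hr := f.rOut_pos
  set E := erosion (2 * f.rOut) Q
  have hmE : MeasurableSet E := measurableSet_erosion (2 * f.rOut) Q
  have hEQ : E ⊆ Q := erosion_subset (by linarith) Q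
  set g := Q.indicator (fun y => ‖G y‖ₑ) with hg_def
  have hg : Measurable g := hG.enorm.indicator hQm
  have hg2 : ∫⁻ z, g z ^ 2 ∂(Lam m n) = ∫⁻ z in Q, ‖G z‖ₑ ^ 2 ∂(Lam m n) := by
    rw [← lintegral_indicator hQm]
    congr 1
    ext z
    by_cases hz : z ∈ Q <;> simp [hg_def, hz]
  set ν := (Lam m n).restrict E
  have hae : ∀ᵐ p ∂(ν.prod ν), p.1 ∈ E ∧ p.2 ∈ E :=
    (ae_prod_of_ae_fst (ae_restrict_mem hmE)).and (ae_prod_of_ae_snd (ae_restrict_mem hmE))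
  have step1 : ∀ᵐ p ∂(ν.prod ν), ‖mollify f φ p.2 - mollify f φ p.1‖ₑ ^ 2 ≤
      ENNReal.ofReal ((n + 1) * d) ^ 2 *
        ∫⁻ q, g ((1 - q.1) • p.1 + q.1 • p.2 - q.2) ^ 2 ∂(segmentMeasure f) := by
    filter_upwards [hae] with p hp
    have h1 := h.enorm_mollify_sub_le f hG hQm hQ hQH hp.1 hp.2
    have h2 := sq_lintegral_le (segmentMeasure f)
      (f := fun q => g ((1 - q.1) • p.1 + q.1 • p.2 - q.2)) (by fun_prop)
    rw [measure_univ, one_mul] at h2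
    calc _ ≤ _ := pow_le_pow_left' h1 2
      _ = _ := mul_pow _ _ _
      _ ≤ _ := by
        gcongr
        exact hd _ (hEQ hp.1) _ (hEQ hp.2)
  calc _ ≤ _ := lintegral_mono_ae step1
    _ = ENNReal.ofReal ((n + 1) * d) ^ 2 * ∫⁻ q, ∫⁻ p,
          g ((1 - q.1) • p.1 + q.1 • p.2 - q.2) ^ 2 ∂(ν.prod ν) ∂(segmentMeasure f) := by
        rw [lintegral_const_mul' _ _ (by finiteness), lintegral_lintegral_swap (by fun_prop)]
    _ ≤ ENNReal.ofReal ((n + 1) * d) ^ 2 * ∫⁻ _,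
          (segConst m n * Lam m n Q * ∫⁻ z, g z ^ 2 ∂(Lam m n)) ∂(segmentMeasure f) := by
        gcongr 1
        refine lintegral_mono_ae ?_
        filter_upwards [ae_segmentMeasure f] with q hq
        exact lintegral_segment_le hm hQ hQH (hg.pow_const 2) hr hq.1 hq.2
    _ = _ := by rw [lintegral_const, measure_univ, mul_one, hg2]

end

/-! ### Removing the mollification -/

section

variable {n : ℕ}

/-- A sequence of bumps shrinking to the origin. -/
def shrinkingBump (n : ℕ) (k : ℕ) : ContDiffBump (0 : Cyl n) :=
  ⟨1 / ((k : ℝ) + 1) / 2, 1 / ((k : ℝ) + 1), by positivity, half_lt_self (by positivity)⟩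

theorem tendsto_shrinkingBump (n : ℕ) :
    Tendsto (fun k => (shrinkingBump n k).rOut) atTop (𝓝 0) :=
  tendsto_one_div_add_atTop_nhds_zero_nat

/-- A compact exhaustion of the half-space. -/
def compactBox (n : ℕ) (N : ℕ) : Set (Cyl n) :=
  {z | 1 / ((N : ℝ) + 1) ≤ z.1} ∩ Metric.closedBall 0 ((N : ℝ) + 1)

theorem isCompact_compactBox (n N : ℕ) : IsCompact (compactBox n N) :=
  (isCompact_closedBall _ _).inter_left (isClosed_le continuous_const continuous_fst)

theorem compactBox_subset_halfSpace (n N : ℕ) : compactBox n N ⊆ halfSpace n := by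
  intro z hz
  have : 0 < 1 / ((N : ℝ) + 1) := by positivity
  exact this.trans_le hz.1

theorem exists_ball_subset_compactBox {z : Cyl n} (hz : z ∈ halfSpace n) :
    ∃ N, Metric.ball z (z.1 / 2) ⊆ compactBox n N := by
  have hz' : (0 : ℝ) < z.1 := hz
  obtain ⟨N, hN⟩ := exists_nat_ge (max (2 / z.1) (‖z‖ + z.1 / 2))
  refine ⟨N, fun y hy => ⟨?_, ?_⟩⟩
  · have h1 : |y.1 - z.1| < z.1 / 2 := (le_max_left _ _).trans_lt hy
    have h2 : 2 / z.1 ≤ (N : ℝ) + 1 := (le_max_left _ _).trans (hN.trans (by linarith))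
    rw [abs_lt] at h1
    have h3 : 1 / ((N : ℝ) + 1) ≤ z.1 / 2 := by
      rw [div_le_div_iff₀ (by positivity) (by positivity)]
      rw [div_le_iff₀ hz'] at h2
      linarith
    change 1 / ((N : ℝ) + 1) ≤ y.1
    linarith [h1.1]
  · rw [mem_closedBall_zero_iff]
    rw [Metric.mem_ball, dist_eq_norm] at hy
    have h1 : ‖y‖ ≤ ‖z‖ + ‖y - z‖ := norm_le_norm_add_norm_sub' y z
    have h2 := (le_max_right _ _).trans hN
    linarith

/-- `φ` need not be integrable up to `ρ = 0`, so Lebesgue differentiation is applied to its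
truncations to compact boxes. Once the bump is small, the mollification at `z` sees only a ball on
which a truncation equals `φ`. -/
theorem ae_tendsto_mollify {φ : Cyl n → ℂ} (h : LocallyIntegrableOn φ (halfSpace n) volume) :
    ∀ᵐ z ∂(volume.restrict (halfSpace n)),
      Tendsto (fun k => mollify (shrinkingBump n k) φ z) atTop (𝓝 (φ z)) := by
  have hN : ∀ N : ℕ, ∀ᵐ z : Cyl n, Tendsto (fun k => ((shrinkingBump n k).normed volume
      ⋆[ContinuousLinearMap.lsmul ℝ ℝ, volume] (compactBox n N).indicator φ) z) atTop
      (𝓝 ((compactBox n N).indicator φ z)) := by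
    intro N
    refine ContDiffBump.ae_convolution_tendsto_right_of_locallyIntegrable (K := 2)
      (tendsto_shrinkingBump n) (Eventually.of_forall fun k => ?_) ?_
    · exact le_of_eq (mul_div_cancel₀ _ two_ne_zero).symm
    · exact ((integrable_indicator_iff (isCompact_compactBox n N).measurableSet).2
        (h.integrableOn_compact_subset (compactBox_subset_halfSpace n N)
          (isCompact_compactBox n N))).locallyIntegrable
  filter_upwards [ae_restrict_mem (measurableSet_halfSpace n),
    ae_restrict_of_ae (ae_all_iff.2 hN)] with z hz hz2
  have hz' : (0 : ℝ) < z.1 := hz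
  obtain ⟨N, hN⟩ := exists_ball_subset_compactBox hz
  have h3 := hz2 N
  rw [Set.indicator_of_mem (hN (Metric.mem_ball_self (by linarith)))] at h3
  refine h3.congr' ?_
  have : ∀ᶠ k in atTop, (shrinkingBump n k).rOut < z.1 / 2 :=
    (tendsto_shrinkingBump n).eventually_lt_const (by linarith)
  filter_upwards [this] with k hk
  rw [convolution_eq_swap, mollify, ← integral_indicator (measurableSet_halfSpace n)]
  congr 1
  ext y
  by_cases hy : (shrinkingBump n k).normed volume (z - y) = 0
  · rw [hy, map_zero, zero_apply]
    symm
    exact Set.indicator_apply_eq_zero.2 fun _ => by simp [hy]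
  · have hy' : z - y ∈ Function.support ((shrinkingBump n k).normed volume) := hy
    rw [ContDiffBump.support_normed_eq, mem_ball_zero_iff] at hy'
    have hyK : y ∈ compactBox n N := hN (by
      rw [Metric.mem_ball, dist_comm, dist_eq_norm]
      exact hy'.trans hk)
    rw [Set.indicator_of_mem hyK, Set.indicator_of_mem (compactBox_subset_halfSpace n N hyK)]
    rfl

theorem stronglyMeasurable_mollify (f : ContDiffBump (0 : Cyl n)) {φ : Cyl n → ℂ}
    (hφ : StronglyMeasurable φ) : StronglyMeasurable (mollify f φ) := by
  unfold mollify
  refine StronglyMeasurable.integral_prod_right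
    (f := fun z y => f.normed volume (z - y) • φ y) ?_
  have h1 : Continuous (fun q : Cyl n × Cyl n => f.normed volume (q.1 - q.2)) :=
    (f.contDiff_normed (n := 0)).continuous.comp (by fun_prop)
  exact h1.stronglyMeasurable.smul (hφ.comp_measurable measurable_snd)

/-- The frontier of a convex set is Lebesgue null, and `Λ` is absolutely continuous. Hence the
erosions exhaust `Q` up to a null set. -/
theorem ae_mem_interior {m : ℝ} {Q : Set (Cyl n)} (hQm : MeasurableSet Q) (hQ : Convex ℝ Q) :
    ∀ᵐ z ∂((Lam m n).restrict Q), z ∈ interior Q := by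
  have h1 : Lam m n (frontier Q) = 0 :=
    ((Lam_absolutelyContinuous m n).trans Measure.restrict_le_self.absolutelyContinuous)
      (hQ.addHaar_frontier volume)
  have h2 : ∀ᵐ z ∂(Lam m n), z ∉ frontier Q := measure_eq_zero_iff_ae_notMem.1 h1
  filter_upwards [ae_restrict_mem hQm, ae_restrict_of_ae h2] with z hz hz2
  by_contra hc
  exact hz2 ⟨subset_closure hz, hc⟩

theorem eventually_mem_erosion {Q : Set (Cyl n)} {z : Cyl n} (hz : z ∈ interior Q) :
    ∀ᶠ k in atTop, z ∈ erosion (2 * (shrinkingBump n k).rOut) Q := by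
  obtain ⟨s, hs, hsQ⟩ := Metric.isOpen_iff.1 isOpen_interior z hz
  have : ∀ᶠ k in atTop, 2 * (shrinkingBump n k).rOut < s := by
    have := (tendsto_shrinkingBump n).const_mul 2
    rw [mul_zero] at this
    exact this.eventually_lt_const hs
  filter_upwards [this] with k hk
  rw [mem_erosion_iff]
  intro e he
  refine interior_subset (hsQ ?_)
  rw [Metric.mem_ball, dist_self_add_left]
  linarith

/-- Fatou along shrinking bumps: the bound for mollifications is uniform in the bump, and the
integrands restricted to the erosions converge almost everywhere. -/
theorem HasDistGradient.lintegral_sub_le_of_measurable {m : ℝ} (hm : 1 ≤ m) {φ : Cyl n → ℂ}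
    {G : Cyl n → EuclideanSpace ℂ (Fin (n + 1))} (h : HasDistGradient φ G)
    (hφ : StronglyMeasurable φ) (hG : Measurable G)
    {Q : Set (Cyl n)} (hQm : MeasurableSet Q) (hQ : Convex ℝ Q) (hQH : Q ⊆ halfSpace n)
    {d : ℝ} (hd : ∀ z ∈ Q, ∀ w ∈ Q, ‖w - z‖ ≤ d) :
    ∫⁻ p, ‖φ p.2 - φ p.1‖ₑ ^ 2 ∂(((Lam m n).restrict Q).prod ((Lam m n).restrict Q)) ≤
      ENNReal.ofReal ((n + 1) * d) ^ 2 *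
        (segConst m n * Lam m n Q * ∫⁻ z in Q, ‖G z‖ₑ ^ 2 ∂(Lam m n)) := by
  set ν := (Lam m n).restrict Q with hν
  set E : ℕ → Set (Cyl n) := fun k => erosion (2 * (shrinkingBump n k).rOut) Q
  have hEm : ∀ k, MeasurableSet (E k) := fun k => measurableSet_erosion _ _
  set F : ℕ → Cyl n × Cyl n → ℝ≥0∞ := fun k => (E k ×ˢ E k).indicator
    (fun p => ‖mollify (shrinkingBump n k) φ p.2 - mollify (shrinkingBump n k) φ p.1‖ₑ ^ 2)
    with hF
  have hM : ∀ k, Measurable (mollify (shrinkingBump n k) φ) := fun k =>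
    (stronglyMeasurable_mollify _ hφ).measurable
  have hFm : ∀ k, Measurable (F k) := fun k =>
    Measurable.indicator (by have := hM k; fun_prop) ((hEm k).prod (hEm k))
  have hac : ν ≪ volume.restrict (halfSpace n) :=
    Measure.restrict_le_self.absolutelyContinuous.trans (Lam_absolutelyContinuous m n)
  have hgood : ∀ᵐ z ∂ν, z ∈ interior Q ∧
      Tendsto (fun k => mollify (shrinkingBump n k) φ z) atTop (𝓝 (φ z)) :=
    (ae_mem_interior hQm hQ).and (hac.ae_le (ae_tendsto_mollify h.1))
  have hlim : ∀ᵐ p ∂(ν.prod ν), ‖φ p.2 - φ p.1‖ₑ ^ 2 ≤ liminf (fun k => F k p) atTop := by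
    filter_upwards [ae_prod_of_ae_fst hgood, ae_prod_of_ae_snd hgood] with p hp1 hp2
    have h1 : Tendsto (fun k => F k p) atTop (𝓝 (‖φ p.2 - φ p.1‖ₑ ^ 2)) := by
      have h2 := ENNReal.Tendsto.pow (n := 2) (hp2.2.sub hp1.2).enorm
      refine h2.congr' ?_
      filter_upwards [eventually_mem_erosion hp1.1, eventually_mem_erosion hp2.1] with k h3 h4
      have h5 : p ∈ E k ×ˢ E k := ⟨h3, h4⟩
      rw [hF]
      simp only [Set.indicator_of_mem h5]
    exact h1.liminf_eq.ge
  calc _ ≤ ∫⁻ p, liminf (fun k => F k p) atTop ∂(ν.prod ν) := lintegral_mono_ae hlim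
    _ ≤ liminf (fun k => ∫⁻ p, F k p ∂(ν.prod ν)) atTop := lintegral_liminf_le hFm
    _ ≤ _ := by
      refine liminf_le_of_le (by isBoundedDefault) fun b hb => ?_
      obtain ⟨k, hk⟩ := hb.exists
      refine hk.trans ?_
      have hE : ν.restrict (E k) = (Lam m n).restrict (E k) := by
        rw [hν, Measure.restrict_restrict (hEm k), Set.inter_eq_self_of_subset_left]
        exact erosion_subset (by have := (shrinkingBump n k).rOut_pos; linarith) Q
      rw [hF, lintegral_indicator ((hEm k).prod (hEm k)), ← Measure.prod_restrict, hE]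
      exact h.lintegral_mollify_sub_le (shrinkingBump n k) hm hG hQm hQ hQH hd

theorem LocallyIntegrableOn.congr_ae {F : Type*} [NormedAddCommGroup F] {f g : Cyl n → F}
    (hf : LocallyIntegrableOn f (halfSpace n) volume)
    (h : f =ᵐ[volume.restrict (halfSpace n)] g) :
    LocallyIntegrableOn g (halfSpace n) volume := by
  intro z hz
  obtain ⟨s, hs, hi⟩ := hf z hz
  refine ⟨s ∩ halfSpace n, inter_mem hs self_mem_nhdsWithin, ?_⟩
  exact (hi.mono_set Set.inter_subset_left).congr_fun_ae
    (ae_mono (Measure.restrict_mono Set.inter_subset_right le_rfl) h)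

theorem HasDistGradient.congr {φ φ' : Cyl n → ℂ}
    {G G' : Cyl n → EuclideanSpace ℂ (Fin (n + 1))} (h : HasDistGradient φ G)
    (hφ : φ =ᵐ[volume.restrict (halfSpace n)] φ') (hG : G =ᵐ[volume.restrict (halfSpace n)] G') :
    HasDistGradient φ' G' := by
  refine ⟨LocallyIntegrableOn.congr_ae h.1 hφ, LocallyIntegrableOn.congr_ae h.2.1 hG,
    fun η h1 h2 h3 i => ?_⟩
  have := h.2.2 η h1 h2 h3 i
  have e1 : ∫ z in halfSpace n, fderiv ℝ η z (coordDir n i) • φ z =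
      ∫ z in halfSpace n, fderiv ℝ η z (coordDir n i) • φ' z :=
    integral_congr_ae (hφ.mono fun z hz => by simp only [hz])
  have e2 : ∫ z in halfSpace n, η z • G z i = ∫ z in halfSpace n, η z • G' z i :=
    integral_congr_ae (hG.mono fun z hz => by simp only [hz])
  rwa [e1, e2] at this

/-- **Poincaré inequality** on a convex set, in double integral form. -/
theorem HasDistGradient.lintegral_sub_le {m : ℝ} (hm : 1 ≤ m) {φ : Cyl n → ℂ}
    {G : Cyl n → EuclideanSpace ℂ (Fin (n + 1))} (h : HasDistGradient φ G)
    {Q : Set (Cyl n)} (hQm : MeasurableSet Q) (hQ : Convex ℝ Q) (hQH : Q ⊆ halfSpace n)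
    {d : ℝ} (hd : ∀ z ∈ Q, ∀ w ∈ Q, ‖w - z‖ ≤ d) :
    ∫⁻ p, ‖φ p.2 - φ p.1‖ₑ ^ 2 ∂(((Lam m n).restrict Q).prod ((Lam m n).restrict Q)) ≤
      ENNReal.ofReal ((n + 1) * d) ^ 2 *
        (segConst m n * Lam m n Q * ∫⁻ z in Q, ‖G z‖ₑ ^ 2 ∂(Lam m n)) := by
  have hφ := h.1.aestronglyMeasurable
  have hG := h.2.1.aestronglyMeasurable
  have hac : (Lam m n).restrict Q ≪ volume.restrict (halfSpace n) :=
    Measure.restrict_le_self.absolutelyContinuous.trans (Lam_absolutelyContinuous m n)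
  have key := (h.congr hφ.ae_eq_mk hG.ae_eq_mk).lintegral_sub_le_of_measurable hm
    hφ.stronglyMeasurable_mk hG.stronglyMeasurable_mk.measurable hQm hQ hQH hd
  have e1 := hac.ae_le hφ.ae_eq_mk
  have e2 := hac.ae_le hG.ae_eq_mk
  rw [lintegral_congr_ae (g := fun z => ‖G z‖ₑ ^ 2) (by
      filter_upwards [e2] with z hz
      rw [hz]),
    lintegral_congr_ae (g := fun p : Cyl n × Cyl n => ‖φ p.2 - φ p.1‖ₑ ^ 2) (by
      filter_upwards [ae_prod_of_ae_fst e1, ae_prod_of_ae_snd e1] with p hp1 hp2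
      rw [hp1, hp2])] at key
  exact key

end

/-! ### Averages and the Poincaré inequality on boxes -/

section

variable {n : ℕ}

/-- Jensen's inequality for the square, in unnormalized form. -/
theorem measure_mul_enorm_average_sub_sq_le {α : Type*} [MeasurableSpace α] {ν : Measure α}
    [IsFiniteMeasure ν] [NeZero ν] {f : α → ℂ} (hf : Integrable f ν) (c : ℂ) :
    ν Set.univ * ‖(⨍ x, f x ∂ν) - c‖ₑ ^ 2 ≤ ∫⁻ x, ‖f x - c‖ₑ ^ 2 ∂ν := by
  have hν : ν Set.univ ≠ 0 := NeZero.ne _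
  have hν' : ν Set.univ ≠ ⊤ := measure_ne_top _ _
  have h1 : (⨍ x, f x ∂ν) - c = ⨍ x, (f x - c) ∂ν := by
    rw [average_eq, average_eq, integral_sub hf (integrable_const c), integral_const, smul_sub,
      smul_smul, inv_mul_cancel₀, one_smul]
    exact (measureReal_ne_zero_iff).2 hν
  have h2 : ‖⨍ x, (f x - c) ∂ν‖ₑ ≤ (ν Set.univ)⁻¹ * ∫⁻ x, ‖f x - c‖ₑ ∂ν := by
    rw [average_eq, enorm_smul]
    refine mul_le_mul' ?_ (enorm_integral_le_lintegral_enorm _)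
    rw [measureReal_def, ← ENNReal.toReal_inv,
      Real.enorm_eq_ofReal ENNReal.toReal_nonneg, ENNReal.ofReal_toReal (by simpa using hν)]
  calc ν Set.univ * ‖(⨍ x, f x ∂ν) - c‖ₑ ^ 2
      ≤ ν Set.univ * ((ν Set.univ)⁻¹ * ∫⁻ x, ‖f x - c‖ₑ ∂ν) ^ 2 := by
        rw [h1]
        gcongr
    _ = (ν Set.univ)⁻¹ * (∫⁻ x, ‖f x - c‖ₑ ∂ν) ^ 2 := by
        rw [mul_pow, sq (ν Set.univ)⁻¹, mul_assoc, ← mul_assoc,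
          ENNReal.mul_inv_cancel hν hν', one_mul]
    _ ≤ (ν Set.univ)⁻¹ * (ν Set.univ * ∫⁻ x, ‖f x - c‖ₑ ^ 2 ∂ν) := by
        gcongr
        exact sq_lintegral_le ν (hf.1.sub aestronglyMeasurable_const).enorm
    _ = _ := by rw [← mul_assoc, ENNReal.inv_mul_cancel hν hν', one_mul]

theorem eLpNorm_two_sq {α F : Type*} [MeasurableSpace α] [NormedAddCommGroup F] (ν : Measure α)
    (f : α → F) : eLpNorm f 2 ν ^ 2 = ∫⁻ x, ‖f x‖ₑ ^ 2 ∂ν := by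
  have h := eLpNorm_nnreal_pow_eq_lintegral (f := f) (μ := ν) (p := 2) two_ne_zero
  simp only [NNReal.coe_ofNat, ENNReal.coe_ofNat, ENNReal.rpow_ofNat] at h
  exact h

theorem memLp_two_iff {α F : Type*} [MeasurableSpace α] [NormedAddCommGroup F] {ν : Measure α}
    {f : α → F} (hf : AEStronglyMeasurable f ν) :
    MemLp f 2 ν ↔ ∫⁻ x, ‖f x‖ₑ ^ 2 ∂ν < ⊤ := by
  rw [← eLpNorm_two_sq]
  constructor
  · exact fun h => ENNReal.pow_lt_top h.2
  · exact fun h => ⟨hf, by simpa using h⟩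

/-- By Tonelli `f - f z` is square integrable for almost every `z`; one such `z` suffices, constants
being square integrable for a finite measure. -/
theorem memLp_of_lintegral_sub_lt_top {α : Type*} [MeasurableSpace α] {ν : Measure α}
    [IsFiniteMeasure ν] [NeZero ν] {f : α → ℂ} (hf : AEStronglyMeasurable f ν)
    (h : ∫⁻ p, ‖f p.2 - f p.1‖ₑ ^ 2 ∂(ν.prod ν) < ⊤) : MemLp f 2 ν := by
  have hm : AEMeasurable (fun p : α × α => ‖f p.2 - f p.1‖ₑ ^ 2) (ν.prod ν) :=
    (hf.comp_snd.sub hf.comp_fst).enorm.pow_const 2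
  rw [lintegral_prod _ hm] at h
  obtain ⟨z, hz⟩ := (ae_lt_top' hm.lintegral_prod_right' h.ne).exists
  have h1 : MemLp (fun w => f w - f z) 2 ν :=
    (memLp_two_iff (hf.sub aestronglyMeasurable_const)).2 hz
  have h2 := h1.add (memLp_const (f z))
  have e : (fun w => f w - f z) + (fun _ => f z) = f := by
    ext w
    simp
  rwa [e] at h2

theorem lintegral_sub_average_le {α : Type*} [MeasurableSpace α] {ν : Measure α}
    [IsFiniteMeasure ν] [NeZero ν] {f : α → ℂ} (hf : Integrable f ν) :
    ν Set.univ * ∫⁻ z, ‖f z - ⨍ x, f x ∂ν‖ₑ ^ 2 ∂ν ≤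
      ∫⁻ p, ‖f p.2 - f p.1‖ₑ ^ 2 ∂(ν.prod ν) := by
  have hm : AEMeasurable (fun p : α × α => ‖f p.2 - f p.1‖ₑ ^ 2) (ν.prod ν) :=
    (hf.1.comp_snd.sub hf.1.comp_fst).enorm.pow_const 2
  rw [lintegral_prod _ hm, ← lintegral_const_mul' _ _ (measure_ne_top _ _)]
  refine lintegral_mono fun z => ?_
  rw [enorm_sub_rev]
  exact measure_mul_enorm_average_sub_sq_le hf (f z)

/-- A half-open box with side length `L`. -/
def box (a : ℝ) (y : EuclideanSpace ℝ (Fin n)) (L : ℝ) : Set (Cyl n) :=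
  Set.Ioc a (a + L) ×ˢ {x | ∀ j, x j ∈ Set.Ioc (y j) (y j + L)}

theorem measurableSet_box (a : ℝ) (y : EuclideanSpace ℝ (Fin n)) (L : ℝ) :
    MeasurableSet (box a y L) := by
  refine measurableSet_Ioc.prod ?_
  rw [Set.ofPred_forall]
  refine MeasurableSet.iInter fun j => ?_
  exact (by fun_prop : Measurable fun x : EuclideanSpace ℝ (Fin n) => x j) measurableSet_Ioc

theorem convex_box (a : ℝ) (y : EuclideanSpace ℝ (Fin n)) (L : ℝ) : Convex ℝ (box a y L) := by
  refine (convex_Ioc _ _).prod ?_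
  rw [Set.ofPred_forall]
  refine convex_iInter fun j => ?_
  exact (convex_Ioc (y j) (y j + L)).is_linear_preimage
    (f := fun x : EuclideanSpace ℝ (Fin n) => x j) ⟨fun _ _ => rfl, fun _ _ => rfl⟩

theorem box_subset_halfSpace {a : ℝ} (ha : 0 ≤ a) (y : EuclideanSpace ℝ (Fin n)) (L : ℝ) :
    box a y L ⊆ halfSpace n := fun _ hz => ha.trans_lt hz.1.1

theorem box_mono (a : ℝ) (y : EuclideanSpace ℝ (Fin n)) {L L' : ℝ} (h : L ≤ L') :
    box a y L ⊆ box a y L' := fun _ hz =>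
  ⟨⟨hz.1.1, hz.1.2.trans (by linarith)⟩, fun j => ⟨(hz.2 j).1, (hz.2 j).2.trans (by linarith)⟩⟩

theorem norm_sub_le_of_mem_box {a : ℝ} {y : EuclideanSpace ℝ (Fin n)} {L : ℝ} (hL : 0 ≤ L) :
    ∀ z ∈ box a y L, ∀ w ∈ box a y L, ‖w - z‖ ≤ (n + 1) * L := by
  intro z hz w hw
  rw [Prod.norm_def]
  refine max_le ?_ ?_
  · rw [Real.norm_eq_abs, abs_le]
    have h1 := hz.1
    have h2 := hw.1
    simp only [Prod.fst_sub]
    have : (0 : ℝ) ≤ n * L := by positivity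
    constructor <;> nlinarith [h1.1, h1.2, h2.1, h2.2]
  · refine le_of_sq_le_sq ?_ (by positivity)
    rw [EuclideanSpace.norm_sq_eq]
    calc ∑ j, ‖(w - z).2 j‖ ^ 2 ≤ ∑ _j : Fin n, L ^ 2 := by
          refine Finset.sum_le_sum fun j _ => ?_
          gcongr
          have h1 := hz.2 j
          have h2 := hw.2 j
          simp only [Prod.snd_sub, PiLp.sub_apply, Real.norm_eq_abs, abs_le]
          constructor <;> linarith [h1.1, h1.2, h2.1, h2.2]
      _ = n * L ^ 2 := by simp
      _ ≤ ((n + 1) * L) ^ 2 := by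
          rw [mul_pow]
          gcongr
          nlinarith [(Nat.cast_nonneg n : (0 : ℝ) ≤ n)]

theorem volume_cube (y : EuclideanSpace ℝ (Fin n)) (L : ℝ) :
    volume {x : EuclideanSpace ℝ (Fin n) | ∀ j, x j ∈ Set.Ioc (y j) (y j + L)} =
      ENNReal.ofReal L ^ n := by
  have h := (EuclideanSpace.volume_preserving_symm_measurableEquiv_toLp (Fin n)).measure_preimage
    (s := Set.univ.pi fun j => Set.Ioc (y j) (y j + L))
    (MeasurableSet.univ_pi fun _ => measurableSet_Ioc).nullMeasurableSet
  rw [Real.volume_pi_Ioc] at h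
  simp only [add_sub_cancel_left, Finset.prod_const, Finset.card_univ, Fintype.card_fin] at h
  rw [← h]
  congr 1
  ext x
  simp

theorem volume_box (a : ℝ) (y : EuclideanSpace ℝ (Fin n)) (L : ℝ) :
    volume (box a y L) = ENNReal.ofReal L ^ (n + 1) := by
  rw [box, Measure.volume_eq_prod, Measure.prod_prod, volume_cube, Real.volume_Ioc,
    add_sub_cancel_left, pow_succ']

theorem Lam_box_lt_top {m : ℝ} (hm : 1 ≤ m) {a : ℝ} (ha : 0 ≤ a)
    (y : EuclideanSpace ℝ (Fin n)) (L : ℝ) : Lam m n (box a y L) < ⊤ := by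
  rw [Lam_apply m (measurableSet_box a y L) (box_subset_halfSpace ha y L)]
  have hω := (sphereArea_pos hm).le
  calc ∫⁻ z in box a y L, weight m n z
      ≤ ∫⁻ _ in box a y L, ENNReal.ofReal (sphereArea m * (a + L) ^ (m - 1)) := by
        refine setLIntegral_mono' (measurableSet_box a y L) fun z hz => ?_
        refine ENNReal.ofReal_le_ofReal ?_
        have : (0 : ℝ) < z.1 := box_subset_halfSpace ha y L hz
        gcongr
        exact hz.1.2
    _ < ⊤ := by
        rw [setLIntegral_const, volume_box]
        finiteness

/-- The constant in the lower bound for `Λ` of a box. -/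
def boxConst (m : ℝ) : ℝ := sphereArea m * (1 / 2) ^ m

theorem boxConst_pos {m : ℝ} (hm : 1 ≤ m) : 0 < boxConst m := by
  have := sphereArea_pos hm
  unfold boxConst
  positivity

/-- The upper half of the box has height at least `L / 2`, which bounds the density below there. The
estimate is uniform in the position of the box, including boxes touching `ρ = 0`. -/
theorem le_Lam_box {m : ℝ} (hm : 1 ≤ m) {a : ℝ} (ha : 0 ≤ a)
    (y : EuclideanSpace ℝ (Fin n)) {L : ℝ} (hL : 0 < L) :
    ENNReal.ofReal (boxConst m * L ^ (m + n)) ≤ Lam m n (box a y L) := by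
  have hω := (sphereArea_pos hm).le
  set S : Set (Cyl n) := Set.Ioc (a + L / 2) (a + L) ×ˢ
    {x | ∀ j, x j ∈ Set.Ioc (y j) (y j + L)} with hS
  have hSB : S ⊆ box a y L := Set.prod_mono (Set.Ioc_subset_Ioc_left (by linarith)) subset_rfl
  have hvol : volume S = ENNReal.ofReal (L / 2) * ENNReal.ofReal L ^ n := by
    rw [hS, Measure.volume_eq_prod, Measure.prod_prod, volume_cube, Real.volume_Ioc]
    congr 2
    ring
  rw [Lam_apply m (measurableSet_box a y L) (box_subset_halfSpace ha y L)]
  calc ENNReal.ofReal (boxConst m * L ^ (m + n))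
      = ENNReal.ofReal (sphereArea m * (L / 2) ^ (m - 1)) * volume S := by
        rw [hvol, ← ENNReal.ofReal_pow hL.le, ← ENNReal.ofReal_mul (by positivity),
          ← ENNReal.ofReal_mul (by positivity)]
        congr 1
        have e : (L / 2) ^ (m - 1) * (L / 2) = (L / 2) ^ m := by
          rw [← Real.rpow_add_one (by positivity), sub_add_cancel]
        have e' : (1 / 2) ^ m * L ^ m = (L / 2) ^ m := by
          rw [← Real.mul_rpow (by norm_num) hL.le, one_div_mul_eq_div]
        rw [Real.rpow_add hL, Real.rpow_natCast, boxConst]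
        linear_combination sphereArea m * L ^ n * (e' - e)
    _ = ∫⁻ _ in S, ENNReal.ofReal (sphereArea m * (L / 2) ^ (m - 1)) := by
        rw [setLIntegral_const]
    _ ≤ ∫⁻ _ in box a y L ∩ {z | L / 2 ≤ z.1},
          ENNReal.ofReal (sphereArea m * (L / 2) ^ (m - 1)) := by
        refine lintegral_mono_set fun z hz => ⟨hSB hz, ?_⟩
        have : a + L / 2 < z.1 := hz.1.1
        change L / 2 ≤ z.1
        linarith
    _ ≤ ∫⁻ z in box a y L ∩ {z | L / 2 ≤ z.1}, weight m n z := by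
        refine setLIntegral_mono' ((measurableSet_box a y L).inter
          (measurableSet_le measurable_const measurable_fst)) fun z hz => ?_
        refine ENNReal.ofReal_le_ofReal ?_
        have : L / 2 ≤ z.1 := hz.2
        gcongr
    _ ≤ _ := lintegral_mono_set Set.inter_subset_left

theorem Lam_box_pos {m : ℝ} (hm : 1 ≤ m) {a : ℝ} (ha : 0 ≤ a)
    (y : EuclideanSpace ℝ (Fin n)) {L : ℝ} (hL : 0 < L) : 0 < Lam m n (box a y L) := by
  refine lt_of_lt_of_le (ENNReal.ofReal_pos.2 ?_) (le_Lam_box hm ha y hL)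
  have := boxConst_pos hm
  positivity

/-- The average of `φ` over a box. -/
def boxAvg (m : ℝ) (φ : Cyl n → ℂ) (a : ℝ) (y : EuclideanSpace ℝ (Fin n)) (L : ℝ) : ℂ :=
  ⨍ z in box a y L, φ z ∂(Lam m n)

/-- The Poincaré constant of boxes. -/
def poincareConst (m : ℝ) (n : ℕ) : ℝ :=
  ((n + 1) * (n + 1)) ^ 2 * (4 ^ (m - 1) * 2 ^ (n + 1))

theorem poincareConst_pos (m : ℝ) (n : ℕ) : 0 < poincareConst m n := by
  unfold poincareConst
  positivity

theorem ofReal_poincareConst_mul (m : ℝ) (n : ℕ) {L : ℝ} (hL : 0 ≤ L) :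
    ENNReal.ofReal ((n + 1) * ((n + 1) * L)) ^ 2 * segConst m n =
      ENNReal.ofReal (poincareConst m n * L ^ 2) := by
  rw [segConst, ← ENNReal.ofReal_pow (by positivity),
    show (2 : ℝ≥0∞) ^ (n + 1) = ENNReal.ofReal (2 ^ (n + 1)) by
      rw [ENNReal.ofReal_pow (by norm_num)]; simp,
    ← ENNReal.ofReal_mul (by positivity), ← ENNReal.ofReal_mul (by positivity), poincareConst]
  congr 1
  ring

section

variable {m : ℝ} {φ : Cyl n → ℂ} {G : Cyl n → EuclideanSpace ℂ (Fin (n + 1))}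

theorem HasDistGradient.aestronglyMeasurable (h : HasDistGradient φ G) :
    AEStronglyMeasurable φ (Lam m n) :=
  h.1.aestronglyMeasurable.mono_ac (Lam_absolutelyContinuous m n)

theorem isFiniteMeasure_restrict_box (hm : 1 ≤ m) {a : ℝ} (ha : 0 ≤ a)
    (y : EuclideanSpace ℝ (Fin n)) (L : ℝ) : IsFiniteMeasure ((Lam m n).restrict (box a y L)) :=
  ⟨by simpa using Lam_box_lt_top hm ha y L⟩

theorem neZero_restrict_box (hm : 1 ≤ m) {a : ℝ} (ha : 0 ≤ a)
    (y : EuclideanSpace ℝ (Fin n)) {L : ℝ} (hL : 0 < L) :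
    NeZero ((Lam m n).restrict (box a y L)) :=
  ⟨by
    intro h0
    have := Lam_box_pos hm ha y hL
    rw [Measure.restrict_eq_zero] at h0
    exact this.ne' h0⟩

theorem HasDistGradient.memLp_box (h : HasDistGradient φ G) (hm : 1 ≤ m)
    (hG : MemLp G 2 (Lam m n)) {a : ℝ} (ha : 0 ≤ a) (y : EuclideanSpace ℝ (Fin n)) (L : ℝ) :
    MemLp φ 2 ((Lam m n).restrict (box a y L)) := by
  wlog hL : 0 < L generalizing L
  · exact (this 1 one_pos).mono_measure
      (Measure.restrict_mono (box_mono a y (by linarith)) le_rfl)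
  have := isFiniteMeasure_restrict_box hm ha y L
  have := neZero_restrict_box hm ha y hL
  refine memLp_of_lintegral_sub_lt_top h.aestronglyMeasurable.restrict ?_
  refine (h.lintegral_sub_le hm (measurableSet_box a y L) (convex_box a y L)
    (box_subset_halfSpace ha y L) (norm_sub_le_of_mem_box hL.le)).trans_lt ?_
  have h1 : ∫⁻ z in box a y L, ‖G z‖ₑ ^ 2 ∂(Lam m n) < ⊤ :=
    (setLIntegral_le_lintegral _ _).trans_lt ((memLp_two_iff hG.1).1 hG)
  have h2 := Lam_box_lt_top hm ha y L
  rw [segConst]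
  finiteness

theorem HasDistGradient.integrableOn_box (h : HasDistGradient φ G) (hm : 1 ≤ m)
    (hG : MemLp G 2 (Lam m n)) {a : ℝ} (ha : 0 ≤ a) (y : EuclideanSpace ℝ (Fin n)) (L : ℝ) :
    IntegrableOn φ (box a y L) (Lam m n) := by
  have := isFiniteMeasure_restrict_box hm ha y L
  exact (h.memLp_box hm hG ha y L).integrable one_le_two

/-- **Poincaré inequality** on a box. -/
theorem HasDistGradient.poincare_box (h : HasDistGradient φ G) (hm : 1 ≤ m)
    (hG : MemLp G 2 (Lam m n)) {a : ℝ} (ha : 0 ≤ a) (y : EuclideanSpace ℝ (Fin n)) {L : ℝ}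
    (hL : 0 < L) :
    ∫⁻ z in box a y L, ‖φ z - boxAvg m φ a y L‖ₑ ^ 2 ∂(Lam m n) ≤
      ENNReal.ofReal (poincareConst m n * L ^ 2) *
        ∫⁻ z in box a y L, ‖G z‖ₑ ^ 2 ∂(Lam m n) := by
  have := isFiniteMeasure_restrict_box hm ha y L
  have := neZero_restrict_box hm ha y hL
  have h1 := lintegral_sub_average_le (h.integrableOn_box hm hG ha y L)
  have h2 := h.lintegral_sub_le hm (measurableSet_box a y L) (convex_box a y L)
    (box_subset_halfSpace ha y L) (norm_sub_le_of_mem_box hL.le)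
  have h3 := h1.trans h2
  rw [Measure.restrict_apply_univ] at h3
  refine (ENNReal.mul_le_mul_iff_right (Lam_box_pos hm ha y hL).ne'
    (Lam_box_lt_top hm ha y L).ne).1 (h3.trans_eq ?_)
  rw [← ofReal_poincareConst_mul m n hL.le]
  ring

end

end

/-! ### Control of averages by the norm, and tilings -/

section

variable {n : ℕ} {m : ℝ} {φ : Cyl n → ℂ} {G : Cyl n → EuclideanSpace ℂ (Fin (n + 1))}

theorem lintegral_enorm_sq_eq_ofReal (hG : MemLp G 2 (Lam m n)) :
    ∫⁻ z, ‖G z‖ₑ ^ 2 ∂(Lam m n) = ENNReal.ofReal ((eLpNorm G 2 (Lam m n)).toReal ^ 2) := by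
  rw [← eLpNorm_two_sq, ENNReal.ofReal_pow ENNReal.toReal_nonneg, ENNReal.ofReal_toReal hG.2.ne]

theorem HasDistGradient.poincare_box' (h : HasDistGradient φ G) (hm : 1 ≤ m)
    (hG : MemLp G 2 (Lam m n)) {a : ℝ} (ha : 0 ≤ a) (y : EuclideanSpace ℝ (Fin n)) {L : ℝ}
    (hL : 0 < L) :
    ∫⁻ z in box a y L, ‖φ z - boxAvg m φ a y L‖ₑ ^ 2 ∂(Lam m n) ≤
      ENNReal.ofReal (poincareConst m n * L ^ 2 * (eLpNorm G 2 (Lam m n)).toReal ^ 2) := by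
  have := (poincareConst_pos m n).le
  rw [ENNReal.ofReal_mul (by positivity), ← lintegral_enorm_sq_eq_ofReal hG]
  exact (h.poincare_box hm hG ha y hL).trans (by gcongr; exact Measure.restrict_le_self)

/-- Jensen on the small box with the large-box average as the constant, followed by Poincaré on the
large box. -/
theorem HasDistGradient.norm_boxAvg_sub_sq_le (h : HasDistGradient φ G) (hm : 1 ≤ m)
    (hG : MemLp G 2 (Lam m n)) {a : ℝ} (ha : 0 ≤ a) (y : EuclideanSpace ℝ (Fin n)) {L L' : ℝ}
    (hL : 0 < L) (hL' : L ≤ L') :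
    boxConst m * L ^ (m + n) * ‖boxAvg m φ a y L - boxAvg m φ a y L'‖ ^ 2 ≤
      poincareConst m n * L' ^ 2 * (eLpNorm G 2 (Lam m n)).toReal ^ 2 := by
  have := isFiniteMeasure_restrict_box hm ha y L
  have := neZero_restrict_box hm ha y hL
  have hP := (poincareConst_pos m n).le
  have hc := (boxConst_pos hm).le
  have h1 := measure_mul_enorm_average_sub_sq_le (h.integrableOn_box hm hG ha y L)
    (boxAvg m φ a y L')
  rw [Measure.restrict_apply_univ] at h1
  have h2 := h1.trans ((lintegral_mono_set (box_mono a y hL')).trans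
    (h.poincare_box' hm hG ha y (hL.trans_le hL')))
  rw [← ENNReal.ofReal_le_ofReal_iff (by positivity)]
  refine le_trans ?_ h2
  rw [ENNReal.ofReal_mul (by positivity), ENNReal.ofReal_pow (norm_nonneg _), ofReal_norm]
  gcongr
  · exact le_Lam_box hm ha y hL
  · exact le_rfl

/-- The constant in the comparison of averages over a box and its double. -/
def stepConst (m : ℝ) (n : ℕ) : ℝ := √(4 * poincareConst m n / boxConst m)

/-- The power of `L` is the scaling of a gradient in `L²` in dimension `m + n`; it is negative
exactly when `m + n > 2`, which makes the dyadic sum over growing boxes converge. -/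
theorem HasDistGradient.norm_boxAvg_sub_le (h : HasDistGradient φ G) (hm : 1 ≤ m)
    (hG : MemLp G 2 (Lam m n)) {a : ℝ} (ha : 0 ≤ a) (y : EuclideanSpace ℝ (Fin n)) {L : ℝ}
    (hL : 0 < L) :
    ‖boxAvg m φ a y L - boxAvg m φ a y (2 * L)‖ ≤
      stepConst m n * (eLpNorm G 2 (Lam m n)).toReal * L ^ (1 - (m + n) / 2) := by
  have hP := poincareConst_pos m n
  have hc := boxConst_pos hm
  have h1 := h.norm_boxAvg_sub_sq_le hm hG ha y hL (by linarith : L ≤ 2 * L)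
  refine le_of_sq_le_sq ?_ (by unfold stepConst; positivity)
  have e1 : (L ^ (1 - (m + n) / 2)) ^ 2 * L ^ (m + n) = L ^ 2 := by
    rw [← Real.rpow_natCast, ← Real.rpow_natCast, ← Real.rpow_mul hL.le, ← Real.rpow_add hL]
    congr 1
    push_cast
    ring
  have hpos : 0 < boxConst m * L ^ (m + n) := by positivity
  refine le_of_mul_le_mul_left (h1.trans_eq ?_) hpos
  rw [mul_pow (_ * _) (L ^ (1 - (m + (n : ℝ)) / 2)), mul_pow (stepConst m n), stepConst, Real.sq_sqrt (by positivity)]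
  calc _ = (4 * poincareConst m n) * (eLpNorm G 2 (Lam m n)).toReal ^ 2 *
        ((L ^ (1 - (m + n) / 2)) ^ 2 * L ^ (m + n)) := by rw [e1]; ring
    _ = _ := by
      field_simp

/-- If the average were at least `2ε` in modulus, `φ` would be at distance at least `ε` from it off
the finite-measure set `{|φ| > ε}`. Chebyshev and Poincaré would then bound the measure of the box
by `O(1 + L²)`, whereas it grows at least like `L^(m+n)`. This is what rules out a nonzero constant
at infinity. -/
theorem HasDistGradient.eventually_norm_boxAvg_lt (h : HasDistGradient φ G) (hm : 1 ≤ m)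
    (hmn : 2 < m + (n : ℝ)) (hG : MemLp G 2 (Lam m n))
    (hφ : ∀ ε : ℝ, 0 < ε → Lam m n {z | ε < ‖φ z‖} < ⊤) {a : ℝ} (ha : 0 ≤ a)
    (y : EuclideanSpace ℝ (Fin n)) {ε : ℝ} (hε : 0 < ε) :
    ∀ᶠ L in atTop, ‖boxAvg m φ a y L‖ < 2 * ε := by
  have hP := poincareConst_pos m n
  have hc := boxConst_pos hm
  set K := (eLpNorm G 2 (Lam m n)).toReal
  set S := {z | ε < ‖φ z‖}
  set s := (Lam m n S).toReal
  have hs : Lam m n S = ENNReal.ofReal s := (ENNReal.ofReal_toReal (hφ ε hε).ne).symm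
  have hs0 : 0 ≤ s := ENNReal.toReal_nonneg
  have hlim := (tendsto_rpow_atTop (by linarith : 0 < m + (n : ℝ) - 2)).eventually_gt_atTop
    ((s + poincareConst m n * K ^ 2 / ε ^ 2) / boxConst m)
  filter_upwards [hlim, eventually_ge_atTop 1] with L hL1 hL
  by_contra! hcon
  have hL0 : 0 < L := by linarith
  set c := boxAvg m φ a y L
  have hcover : box a y L ⊆ S ∪ {z | z ∈ box a y L ∧ ENNReal.ofReal (ε ^ 2) ≤ ‖φ z - c‖ₑ ^ 2} := by
    intro z hz
    by_cases hzS : z ∈ S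
    · exact Or.inl hzS
    · refine Or.inr ⟨hz, ?_⟩
      have h1 : ‖φ z‖ ≤ ε := not_lt.1 hzS
      have h2 : ‖c‖ - ‖φ z‖ ≤ ‖φ z - c‖ := by
        rw [norm_sub_rev]
        exact norm_sub_norm_le _ _
      rw [ENNReal.ofReal_pow hε.le, ← ofReal_norm]
      gcongr
      linarith
  have hcheb : ENNReal.ofReal (ε ^ 2) *
      Lam m n {z | z ∈ box a y L ∧ ENNReal.ofReal (ε ^ 2) ≤ ‖φ z - c‖ₑ ^ 2} ≤
      ENNReal.ofReal (poincareConst m n * L ^ 2 * K ^ 2) := by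
    have h1 := mul_meas_ge_le_lintegral₀ (μ := (Lam m n).restrict (box a y L))
      (f := fun z => ‖φ z - c‖ₑ ^ 2)
      ((h.aestronglyMeasurable.restrict.sub aestronglyMeasurable_const).enorm.pow_const 2)
      (ENNReal.ofReal (ε ^ 2))
    rw [Measure.restrict_apply' (measurableSet_box a y L)] at h1
    refine le_trans ?_ (h1.trans (h.poincare_box' hm hG ha y hL0))
    gcongr
    exact fun z hz => ⟨hz.2, hz.1⟩
  have h1 : ENNReal.ofReal (boxConst m * L ^ (m + n)) ≤
      ENNReal.ofReal (s + poincareConst m n * L ^ 2 * K ^ 2 / ε ^ 2) := by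
    rw [ENNReal.ofReal_add hs0 (by positivity), ← hs]
    refine (le_Lam_box hm ha y hL0).trans ((measure_mono hcover).trans
      ((measure_union_le _ _).trans ?_))
    gcongr
    rw [ENNReal.ofReal_div_of_pos (by positivity), ENNReal.le_div_iff_mul_le (by simp [hε.ne'])
      (by simp), mul_comm]
    exact hcheb
  rw [ENNReal.ofReal_le_ofReal_iff (by positivity)] at h1
  have e : L ^ (m + n) = L ^ (m + n - 2) * L ^ 2 := by
    rw [← Real.rpow_natCast L 2, ← Real.rpow_add hL0]
    congr 1
    push_cast
    ring
  rw [div_lt_iff₀ hc] at hL1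
  rw [e] at h1
  have h3 : 1 ≤ L ^ 2 := one_le_pow₀ hL
  have h4 := mul_lt_mul_of_pos_right hL1 (by positivity : 0 < L ^ 2)
  have h5 : s * 1 ≤ s * L ^ 2 := by gcongr
  have h6 : poincareConst m n * K ^ 2 / ε ^ 2 * L ^ 2 = poincareConst m n * L ^ 2 * K ^ 2 / ε ^ 2 := by
    ring
  nlinarith

/-- The constant in the bound of averages over boxes with side length `L`. -/
def avgConst (m : ℝ) (n : ℕ) (L : ℝ) : ℝ :=
  stepConst m n * L ^ (1 - (m + n) / 2) / (1 - 2 ^ (1 - (m + n) / 2))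

theorem two_rpow_lt_one (hmn : 2 < m + (n : ℝ)) : (2 : ℝ) ^ (1 - (m + n) / 2) < 1 :=
  Real.rpow_lt_one_of_one_lt_of_neg (by norm_num) (by linarith)

theorem avgConst_nonneg (hmn : 2 < m + (n : ℝ)) {L : ℝ} (hL : 0 < L) : 0 ≤ avgConst m n L := by
  have := two_rpow_lt_one hmn
  have : 0 < 1 - (2 : ℝ) ^ (1 - (m + n) / 2) := by linarith
  unfold avgConst stepConst
  positivity

/-- Averages of an element of `Ḣ¹` over boxes of a given size are controlled by its norm. -/
theorem HasDistGradient.norm_boxAvg_le (h : HasDistGradient φ G) (hm : 1 ≤ m)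
    (hmn : 2 < m + (n : ℝ)) (hG : MemLp G 2 (Lam m n))
    (hφ : ∀ ε : ℝ, 0 < ε → Lam m n {z | ε < ‖φ z‖} < ⊤) {a : ℝ} (ha : 0 ≤ a)
    (y : EuclideanSpace ℝ (Fin n)) {L : ℝ} (hL : 0 < L) :
    ‖boxAvg m φ a y L‖ ≤ avgConst m n L * (eLpNorm G 2 (Lam m n)).toReal := by
  set q : ℝ := 2 ^ (1 - (m + n) / 2) with hq
  have hq0 : 0 < q := by positivity
  have hq1 : q < 1 := two_rpow_lt_one hmn
  set B := stepConst m n * (eLpNorm G 2 (Lam m n)).toReal * L ^ (1 - (m + n) / 2) with hB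
  have hB0 : 0 ≤ B := by rw [hB, stepConst]; positivity
  -- Dyadic enlargement from a fixed corner: consecutive averages differ by at most `B q^k` with `q
  -- < 1`, and the averages become arbitrarily small, so `u 0` is bounded by the geometric sum.
  set u : ℕ → ℂ := fun k => boxAvg m φ a y (2 ^ k * L)
  have hstep : ∀ k, ‖u k - u (k + 1)‖ ≤ B * q ^ k := by
    intro k
    have h1 := h.norm_boxAvg_sub_le hm hG ha y (by positivity : 0 < 2 ^ k * L)
    rw [Real.mul_rpow (by positivity) hL.le, ← Real.rpow_natCast, ← Real.rpow_mul (by norm_num),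
      mul_comm (k : ℝ), Real.rpow_mul (by norm_num), Real.rpow_natCast, Real.rpow_natCast,
      ← hq] at h1
    have e : u (k + 1) = boxAvg m φ a y (2 * (2 ^ k * L)) := by
      simp only [u]
      congr 1
      ring
    rw [e]
    exact h1.trans_eq (by rw [hB]; ring)
  have hsum : ∀ k, ‖u 0‖ ≤ ‖u k‖ + ∑ i ∈ Finset.range k, B * q ^ i := by
    intro k
    induction k with
    | zero => simp
    | succ k ih =>
      rw [Finset.sum_range_succ]
      have h1 := hstep k
      have h2 : ‖u k‖ ≤ ‖u (k + 1)‖ + ‖u k - u (k + 1)‖ := norm_le_norm_add_norm_sub' _ _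
      linarith
  have hgeom : ∀ k, ∑ i ∈ Finset.range k, B * q ^ i ≤ B / (1 - q) := by
    intro k
    rw [← Finset.mul_sum, div_eq_mul_inv, ← tsum_geometric_of_lt_one hq0.le hq1]
    gcongr
    exact (summable_geometric_of_lt_one hq0.le hq1).sum_le_tsum _ fun i _ => by positivity
  have hfin : ‖u 0‖ ≤ B / (1 - q) := by
    refine le_of_forall_pos_le_add fun ε hε => ?_
    have h1 := h.eventually_norm_boxAvg_lt hm hmn hG hφ ha y (half_pos hε)
    have h2 : Tendsto (fun k : ℕ => (2 : ℝ) ^ k * L) atTop atTop :=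
      (tendsto_pow_atTop_atTop_of_one_lt (by norm_num)).atTop_mul_const hL
    obtain ⟨k, hk⟩ := (h2.eventually h1).exists
    have h3 : ‖u k‖ < ε := by
      have : ‖u k‖ < 2 * (ε / 2) := hk
      linarith
    linarith [hsum k, hgeom k]
  have e0 : u 0 = boxAvg m φ a y L := by simp [u]
  rw [← e0]
  refine hfin.trans_eq ?_
  rw [hB, avgConst]
  ring

theorem HasDistGradient.lintegral_box_le (h : HasDistGradient φ G) (hm : 1 ≤ m)
    (hG : MemLp G 2 (Lam m n)) {a : ℝ} (ha : 0 ≤ a) (y : EuclideanSpace ℝ (Fin n)) {L : ℝ}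
    (hL : 0 < L) :
    ∫⁻ z in box a y L, ‖φ z‖ₑ ^ 2 ∂(Lam m n) ≤
      2 * ENNReal.ofReal (poincareConst m n * L ^ 2 * (eLpNorm G 2 (Lam m n)).toReal ^ 2) +
        2 * (‖boxAvg m φ a y L‖ₑ ^ 2 * Lam m n (box a y L)) := by
  have hm1 : AEMeasurable (fun z => ‖φ z - boxAvg m φ a y L‖ₑ ^ 2)
      ((Lam m n).restrict (box a y L)) :=
    (h.aestronglyMeasurable.restrict.sub aestronglyMeasurable_const).enorm.pow_const 2
  calc ∫⁻ z in box a y L, ‖φ z‖ₑ ^ 2 ∂(Lam m n)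
      ≤ ∫⁻ z in box a y L, (2 * ‖φ z - boxAvg m φ a y L‖ₑ ^ 2 + 2 * ‖boxAvg m φ a y L‖ₑ ^ 2)
          ∂(Lam m n) := by
        refine lintegral_mono fun z => ?_
        have h1 : ‖φ z‖ₑ ≤ ‖φ z - boxAvg m φ a y L‖ₑ + ‖boxAvg m φ a y L‖ₑ := by
          simpa using enorm_add_le (φ z - boxAvg m φ a y L) (boxAvg m φ a y L)
        rw [← mul_add]
        refine (pow_le_pow_left' h1 2).trans ?_
        have := ENNReal.rpow_add_le_mul_rpow_add_rpow ‖φ z - boxAvg m φ a y L‖ₑ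
          ‖boxAvg m φ a y L‖ₑ (p := 2) one_le_two
        norm_num at this
        exact this
    _ = 2 * ∫⁻ z in box a y L, ‖φ z - boxAvg m φ a y L‖ₑ ^ 2 ∂(Lam m n) +
          2 * (‖boxAvg m φ a y L‖ₑ ^ 2 * Lam m n (box a y L)) := by
        rw [lintegral_add_right _ measurable_const, lintegral_const_mul' _ _ (by simp),
          setLIntegral_const, mul_assoc]
    _ ≤ _ := by
        gcongr
        exact h.poincare_box' hm hG ha y hL

/-- The corner of a tile. -/
def tileCorner (l : ℝ) (k : Fin n → ℤ) : EuclideanSpace ℝ (Fin n) :=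
  WithLp.toLp 2 fun j => k j * l

/-- The tiles of side length `l`. -/
def tile (l : ℝ) (i : ℕ × (Fin n → ℤ)) : Set (Cyl n) := box (i.1 * l) (tileCorner l i.2) l

theorem eq_of_mem_Ioc_mul {l : ℝ} (hl : 0 < l) {x : ℝ} {i j : ℤ}
    (hi : x ∈ Set.Ioc (i * l) (i * l + l)) (hj : x ∈ Set.Ioc (j * l) (j * l + l)) : i = j := by
  have h1 : (i : ℝ) < j + 1 := by
    have := hi.1.trans_le hj.2
    nlinarith
  have h2 : (j : ℝ) < i + 1 := by
    have := hj.1.trans_le hi.2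
    nlinarith
  norm_cast at h1 h2
  lia

theorem pairwise_disjoint_tile {l : ℝ} (hl : 0 < l) :
    Pairwise (Function.onFun Disjoint (tile (n := n) l)) := by
  intro i j hij
  refine Set.disjoint_left.2 fun z hi hj => hij ?_
  have h1 : (i.1 : ℤ) = j.1 := by
    refine eq_of_mem_Ioc_mul hl (x := z.1) ?_ ?_
    · exact_mod_cast hi.1
    · exact_mod_cast hj.1
  refine Prod.ext (by exact_mod_cast h1) (funext fun k => ?_)
  exact eq_of_mem_Ioc_mul hl (hi.2 k) (hj.2 k)

theorem mem_Ioc_ceil {l : ℝ} (hl : 0 < l) (x : ℝ) :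
    x ∈ Set.Ioc (((⌈x / l⌉ - 1 : ℤ) : ℝ) * l) (((⌈x / l⌉ - 1 : ℤ) : ℝ) * l + l) := by
  have h1 := Int.ceil_lt_add_one (x / l)
  have h2 := Int.le_ceil (x / l)
  rw [div_le_iff₀ hl] at h2
  rw [← sub_lt_iff_lt_add, lt_div_iff₀ hl] at h1
  push_cast
  constructor <;> linarith

theorem exists_mem_tile {l : ℝ} (hl : 0 < l) {z : Cyl n} (hz : z ∈ halfSpace n) :
    ∃ i, z ∈ tile l i := by
  have hz' : (0 : ℝ) < z.1 := hz
  -- Tiles are open on the left, so the index is the ceiling minus one; `ρ > 0` makes it a natural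
  -- number.
  have h0 : 0 < ⌈z.1 / l⌉ := Int.ceil_pos.2 (by positivity)
  refine ⟨((⌈z.1 / l⌉ - 1).toNat, fun j => ⌈z.2 j / l⌉ - 1), ?_, fun j => mem_Ioc_ceil hl _⟩
  have h1 := mem_Ioc_ceil hl z.1
  have h2 : (((⌈z.1 / l⌉ - 1).toNat : ℕ) : ℝ) = ((⌈z.1 / l⌉ - 1 : ℤ) : ℝ) := by
    have : (((⌈z.1 / l⌉ - 1).toNat : ℕ) : ℤ) = ⌈z.1 / l⌉ - 1 := Int.toNat_of_nonneg (by lia)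
    exact_mod_cast this
  rw [h2]
  exact h1

/-- A set where `φ` is large has small measure if the averages of `φ` over the tiles that meet
the set are small. -/
theorem HasDistGradient.measure_le_of_tile (h : HasDistGradient φ G) (hm : 1 ≤ m)
    (hG : MemLp G 2 (Lam m n)) {l : ℝ} (hl : 0 < l) {ε : ℝ} (hε : 0 < ε) {E : Set (Cyl n)}
    (hEH : E ⊆ halfSpace n) (hE : ∀ z ∈ E, ε < ‖φ z‖)
    (hEt : ∀ i, (E ∩ tile l i).Nonempty →
      ‖boxAvg m φ (i.1 * l) (tileCorner l i.2) l‖ ≤ ε / 2) :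
    ENNReal.ofReal ((ε / 2) ^ 2) * Lam m n E ≤
      ENNReal.ofReal (poincareConst m n * l ^ 2 * (eLpNorm G 2 (Lam m n)).toReal ^ 2) := by
  have ha : ∀ i : ℕ × (Fin n → ℤ), 0 ≤ (i.1 : ℝ) * l := fun i => by positivity
  have hP := (poincareConst_pos m n).le
  have htm : ∀ i : ℕ × (Fin n → ℤ), MeasurableSet (tile l i) := fun i => measurableSet_box _ _ _
  have hcover : E ⊆ ⋃ i, E ∩ tile l i := by
    intro z hz
    obtain ⟨i, hi⟩ := exists_mem_tile hl (hEH hz)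
    exact Set.mem_iUnion.2 ⟨i, hz, hi⟩
  -- The right side keeps the gradient on the tile alone, so summing over disjoint tiles costs
  -- nothing and leaves the small factor `l²`.
  have hpart : ∀ i, ENNReal.ofReal ((ε / 2) ^ 2) * Lam m n (E ∩ tile l i) ≤
      ENNReal.ofReal (poincareConst m n * l ^ 2) * ∫⁻ z in tile l i, ‖G z‖ₑ ^ 2 ∂(Lam m n) := by
    intro i
    rcases Set.eq_empty_or_nonempty (E ∩ tile l i) with he | he
    · simp [he]
    set c := boxAvg m φ (i.1 * l) (tileCorner l i.2) l
    have h1 := mul_meas_ge_le_lintegral₀ (μ := (Lam m n).restrict (tile l i))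
      (f := fun z => ‖φ z - c‖ₑ ^ 2)
      ((h.aestronglyMeasurable.restrict.sub aestronglyMeasurable_const).enorm.pow_const 2)
      (ENNReal.ofReal ((ε / 2) ^ 2))
    rw [Measure.restrict_apply' (htm i)] at h1
    refine le_trans ?_ (h1.trans (h.poincare_box hm hG (ha i) (tileCorner l i.2) hl))
    gcongr
    intro z hz
    have h2 := hE z hz
    have h3 := hEt i he
    have h4 : ‖φ z‖ - ‖c‖ ≤ ‖φ z - c‖ := norm_sub_norm_le _ _
    change ENNReal.ofReal ((ε / 2) ^ 2) ≤ ‖φ z - c‖ₑ ^ 2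
    rw [ENNReal.ofReal_pow (by positivity), ← ofReal_norm]
    gcongr
    linarith
  calc _ ≤ ENNReal.ofReal ((ε / 2) ^ 2) * ∑' i, Lam m n (E ∩ tile l i) := by
        gcongr
        exact (measure_mono hcover).trans (measure_iUnion_le _)
    _ ≤ ∑' i, ENNReal.ofReal (poincareConst m n * l ^ 2) *
          ∫⁻ z in tile l i, ‖G z‖ₑ ^ 2 ∂(Lam m n) := by
        rw [← ENNReal.tsum_mul_left]
        exact ENNReal.tsum_le_tsum hpart
    _ = ENNReal.ofReal (poincareConst m n * l ^ 2) *
          ∫⁻ z in ⋃ i, tile l i, ‖G z‖ₑ ^ 2 ∂(Lam m n) := by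
        rw [ENNReal.tsum_mul_left, lintegral_iUnion htm (pairwise_disjoint_tile hl)]
    _ ≤ _ := by
        rw [ENNReal.ofReal_mul (p := poincareConst m n * l ^ 2) (by positivity),
          ← lintegral_enorm_sq_eq_ofReal hG]
        gcongr
        exact Measure.restrict_le_self

end

/-! ### The gradient map into `L²(Λ)` and local estimates -/

section

variable {n : ℕ} {m : ℝ}

/-- The fundamental lemma of the calculus of variations, coordinate by coordinate. It makes the
chosen representative `distGrad` linear up to null sets. -/
theorem HasDistGradient.ae_eq {φ : Cyl n → ℂ} {G G' : Cyl n → EuclideanSpace ℂ (Fin (n + 1))}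
    (h : HasDistGradient φ G) (h' : HasDistGradient φ G') :
    G =ᵐ[volume.restrict (halfSpace n)] G' := by
  have key : ∀ i, ∀ᵐ z : Cyl n, z ∈ halfSpace n → G z i - G' z i = 0 := by
    intro i
    have l1 := HasDistGradient.coord h.2.1 i
    have l2 := HasDistGradient.coord h'.2.1 i
    refine (isOpen_halfSpace n).ae_eq_zero_of_integral_contDiff_smul_eq_zero
      (f := fun z => G z i - G' z i) (l1.sub l2) fun η h1 h2 h3 => ?_
    have e := h.2.2 η h1 h2 h3 i
    rw [h'.2.2 η h1 h2 h3 i, neg_inj] at e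
    have e0 : ∀ z, z ∉ halfSpace n → η z • (G z i - G' z i) = 0 := by
      intro z hz
      have : η z = 0 := by
        by_contra hc
        exact hz (h3 (subset_tsupport η hc))
      rw [this, zero_smul]
    rw [← setIntegral_eq_integral_of_forall_compl_eq_zero e0]
    simp_rw [smul_sub]
    rw [integral_sub (integrable_mul_of_test l1 h1.continuous h2 h3)
      (integrable_mul_of_test l2 h1.continuous h2 h3), e, sub_self]
  rw [Filter.EventuallyEq, ae_restrict_iff' (measurableSet_halfSpace n)]
  filter_upwards [ae_all_iff.2 key] with z hz hzH
  ext i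
  exact sub_eq_zero.1 (hz i hzH)

theorem HasDistGradient.ae_eq_Lam {φ : Cyl n → ℂ} {G G' : Cyl n → EuclideanSpace ℂ (Fin (n + 1))}
    (h : HasDistGradient φ G) (h' : HasDistGradient φ G') : G =ᵐ[Lam m n] G' :=
  (Lam_absolutelyContinuous m n).ae_le (h.ae_eq h')

theorem hasDistGradient_distGrad (φ : H1 m n) : HasDistGradient (φ : Cyl n → ℂ) (distGrad φ) :=
  φ.2.1.choose_spec.1

theorem memLp_distGrad (φ : H1 m n) : MemLp (distGrad φ) 2 (Lam m n) :=
  φ.2.1.choose_spec.2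

theorem measure_lt_top (φ : H1 m n) (ε : ℝ) (hε : 0 < ε) :
    Lam m n {z | ε < ‖(φ : Cyl n → ℂ) z‖} < ⊤ :=
  φ.2.2 ε hε

/-- The Hilbert space of square integrable gradient fields. -/
abbrev GradSpace (m : ℝ) (n : ℕ) : Type := Lp (EuclideanSpace ℂ (Fin (n + 1))) 2 (Lam m n)

/-- The gradient as a linear map to `L²(Λ)`. -/
def gradLp (m : ℝ) (n : ℕ) : H1 m n →ₗ[ℂ] GradSpace m n where
  toFun φ := (memLp_distGrad φ).toLp
  map_add' φ ψ := by
    rw [← MemLp.toLp_add, MemLp.toLp_eq_toLp_iff]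
    exact (hasDistGradient_distGrad (φ + ψ)).ae_eq_Lam
      ((hasDistGradient_distGrad φ).add (hasDistGradient_distGrad ψ))
  map_smul' c φ := by
    rw [RingHom.id_apply, ← MemLp.toLp_const_smul, MemLp.toLp_eq_toLp_iff]
    exact (hasDistGradient_distGrad (c • φ)).ae_eq_Lam ((hasDistGradient_distGrad φ).smul c)

theorem norm_gradLp (φ : H1 m n) : ‖gradLp m n φ‖ = h1Norm φ :=
  Lp.norm_toLp _ (memLp_distGrad φ)

theorem coeFn_gradLp (φ : H1 m n) : gradLp m n φ =ᵐ[Lam m n] distGrad φ :=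
  MemLp.coeFn_toLp (memLp_distGrad φ)

theorem h1Norm_translate (a : EuclideanSpace ℝ (Fin n)) (φ : H1 m n) :
    h1Norm (translate a φ) = h1Norm φ := by
  have h1 := (hasDistGradient_distGrad (translate a φ)).ae_eq_Lam (m := m)
    ((hasDistGradient_distGrad φ).translate a)
  rw [h1Norm, h1Norm, eLpNorm_congr_ae h1]
  congr 1
  exact eLpNorm_comp_measurePreserving (memLp_distGrad φ).1 (measurePreserving_shift_Lam m a)

theorem norm_boxAvg_le (hm : 1 ≤ m) (hmn : 2 < m + (n : ℝ)) (φ : H1 m n) {a : ℝ} (ha : 0 ≤ a)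
    (y : EuclideanSpace ℝ (Fin n)) {L : ℝ} (hL : 0 < L) :
    ‖boxAvg m (φ : Cyl n → ℂ) a y L‖ ≤ avgConst m n L * h1Norm φ :=
  (hasDistGradient_distGrad φ).norm_boxAvg_le hm hmn (memLp_distGrad φ) (measure_lt_top φ) ha y hL

theorem memLp_box (hm : 1 ≤ m) (φ : H1 m n) {a : ℝ} (ha : 0 ≤ a)
    (y : EuclideanSpace ℝ (Fin n)) (L : ℝ) :
    MemLp (φ : Cyl n → ℂ) 2 ((Lam m n).restrict (box a y L)) :=
  (hasDistGradient_distGrad φ).memLp_box hm (memLp_distGrad φ) ha y L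

/-- Poincaré controls the oscillation and `norm_boxAvg_le` controls the mean. Thus convergence of
gradients forces local `L²` convergence of the functions, which drives the completeness argument. -/
theorem exists_eLpNorm_box_le (hm : 1 ≤ m) (hmn : 2 < m + (n : ℝ)) {a : ℝ} (ha : 0 ≤ a)
    (y : EuclideanSpace ℝ (Fin n)) {L : ℝ} (hL : 0 < L) :
    ∃ M : ℝ, 0 ≤ M ∧ ∀ φ : H1 m n,
      eLpNorm (φ : Cyl n → ℂ) 2 ((Lam m n).restrict (box a y L)) ≤
        ENNReal.ofReal (M * h1Norm φ) := by
  have hP := (poincareConst_pos m n).le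
  have hA := avgConst_nonneg hmn hL
  refine ⟨√(2 * (poincareConst m n * L ^ 2) +
    2 * (avgConst m n L ^ 2 * (Lam m n (box a y L)).toReal)), Real.sqrt_nonneg _, fun φ => ?_⟩
  have hK : 0 ≤ h1Norm φ := ENNReal.toReal_nonneg
  refine (ENNReal.pow_le_pow_left_iff two_ne_zero).1 ?_
  rw [eLpNorm_two_sq]
  refine ((hasDistGradient_distGrad φ).lintegral_box_le hm (memLp_distGrad φ) ha y hL).trans ?_
  rw [← ENNReal.ofReal_pow (by positivity), mul_pow, Real.sq_sqrt (by positivity), add_mul,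
    ENNReal.ofReal_add (by positivity) (by positivity)]
  refine add_le_add ?_ ?_
  · rw [mul_assoc 2, ENNReal.ofReal_mul (by norm_num : (0 : ℝ) ≤ 2)]
    simp [h1Norm]
  · rw [mul_assoc 2, ENNReal.ofReal_mul (by norm_num : (0 : ℝ) ≤ 2), mul_right_comm, ← mul_pow,
      ENNReal.ofReal_mul (by positivity), ENNReal.ofReal_toReal (Lam_box_lt_top hm ha y L).ne,
      ENNReal.ofReal_pow (by positivity)]
    simp only [ENNReal.ofReal_ofNat]
    gcongr
    rw [← ofReal_norm]
    exact ENNReal.ofReal_le_ofReal (norm_boxAvg_le hm hmn φ ha y hL)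

/-- On a compact subset of the open half-space `ρ` has a positive minimum, hence so does the
density. -/
theorem exists_volume_restrict_le (hm : 1 ≤ m) {K : Set (Cyl n)} (hK : IsCompact K)
    (hKH : K ⊆ halfSpace n) :
    ∃ C : ℝ≥0∞, C ≠ ⊤ ∧ volume.restrict K ≤ C • (Lam m n).restrict K := by
  have hω := sphereArea_pos hm
  obtain ⟨r, hr, hrK⟩ : ∃ r : ℝ, 0 < r ∧ ∀ z ∈ K, r ≤ z.1 := by
    rcases K.eq_empty_or_nonempty with rfl | hne
    · exact ⟨1, one_pos, by simp⟩
    · obtain ⟨z, hz, hmin⟩ := hK.exists_isMinOn hne continuous_fst.continuousOn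
      exact ⟨z.1, hKH hz, fun w hw => hmin hw⟩
  have hc : 0 < sphereArea m * r ^ (m - 1) := by positivity
  refine ⟨(ENNReal.ofReal (sphereArea m * r ^ (m - 1)))⁻¹, by simpa using hc, ?_⟩
  refine Measure.le_iff.2 fun s hs => ?_
  rw [Measure.smul_apply, Measure.restrict_apply hs, Measure.restrict_apply hs,
    Lam_apply m (hs.inter hK.measurableSet) (Set.inter_subset_right.trans hKH), smul_eq_mul,
    ← ENNReal.mul_le_iff_le_inv (by simpa using hc) (by simp), ← setLIntegral_const]
  refine setLIntegral_mono' (hs.inter hK.measurableSet) fun z hz => ENNReal.ofReal_le_ofReal ?_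
  have := hrK z hz.2
  gcongr

theorem integrableOn_of_memLp_Lam (hm : 1 ≤ m) {F : Type*} [NormedAddCommGroup F] {f : Cyl n → F}
    {K : Set (Cyl n)} (hK : IsCompact K) (hKH : K ⊆ halfSpace n)
    (hf : MemLp f 2 ((Lam m n).restrict K)) : IntegrableOn f K volume := by
  obtain ⟨C, hC, hle⟩ := exists_volume_restrict_le hm hK hKH
  have : IsFiniteMeasure (volume.restrict K) := ⟨by simpa using hK.measure_lt_top⟩
  exact (hf.of_measure_le_smul hC hle).integrable one_le_two

/-- Cauchy–Schwarz on the compact support of `θ`, where Lebesgue measure is dominated by a multiple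
of `Λ`. -/
theorem tendsto_integral_smul (hm : 1 ≤ m) {f : Cyl n → ℂ} {u : ℕ → Cyl n → ℂ}
    (hf : LocallyIntegrableOn f (halfSpace n) volume)
    (hu : ∀ k, LocallyIntegrableOn (u k) (halfSpace n) volume) {θ : Cyl n → ℝ}
    (hθ : Continuous θ) (hθc : HasCompactSupport θ) (hθH : tsupport θ ⊆ halfSpace n)
    (hlim : Tendsto (fun k => eLpNorm (u k - f) 2 ((Lam m n).restrict (tsupport θ))) atTop
      (𝓝 0)) :
    Tendsto (fun k => ∫ z in halfSpace n, θ z • u k z) atTop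
      (𝓝 (∫ z in halfSpace n, θ z • f z)) := by
  refine tendsto_integral_of_L1 _ (integrable_mul_of_test hf hθ hθc hθH).1
    (Eventually.of_forall fun k => integrable_mul_of_test (hu k) hθ hθc hθH) ?_
  have hK : IsCompact (tsupport θ) := hθc
  obtain ⟨C, hC, hle⟩ := exists_volume_restrict_le hm hK hθH
  obtain ⟨B, hB⟩ := hθc.exists_bound_of_continuous hθ
  have hb : ∀ k, ∫⁻ z in halfSpace n, ‖θ z • u k z - θ z • f z‖ₑ ≤
      ENNReal.ofReal B * (volume (tsupport θ) * C *
        eLpNorm (u k - f) 2 ((Lam m n).restrict (tsupport θ)) ^ 2) ^ (1 / 2 : ℝ) := by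
    intro k
    have hmeas : AEMeasurable (fun z => ‖u k z - f z‖ₑ) (volume.restrict (tsupport θ)) := by
      have := ((hu k).aestronglyMeasurable.sub hf.aestronglyMeasurable).enorm
      exact this.mono_measure (Measure.restrict_mono hθH le_rfl)
    calc ∫⁻ z in halfSpace n, ‖θ z • u k z - θ z • f z‖ₑ
        ≤ ∫⁻ z in halfSpace n, (tsupport θ).indicator
            (fun z => ENNReal.ofReal B * ‖u k z - f z‖ₑ) z := by
          refine lintegral_mono fun z => ?_
          by_cases hz : z ∈ tsupport θ
          · rw [Set.indicator_of_mem hz, ← smul_sub, enorm_smul]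
            gcongr
            rw [← ofReal_norm]
            exact ENNReal.ofReal_le_ofReal (hB z)
          · simp [image_eq_zero_of_notMem_tsupport hz]
      _ ≤ ∫⁻ z, (tsupport θ).indicator (fun z => ENNReal.ofReal B * ‖u k z - f z‖ₑ) z :=
          setLIntegral_le_lintegral _ _
      _ = ENNReal.ofReal B * ∫⁻ z in tsupport θ, ‖u k z - f z‖ₑ := by
          rw [lintegral_indicator hK.measurableSet, lintegral_const_mul' _ _ (by simp)]
      _ ≤ _ := by
          gcongr
          rw [one_div, ENNReal.le_rpow_inv_iff (by norm_num), eLpNorm_two_sq, ENNReal.rpow_two]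
          refine (sq_lintegral_le _ hmeas).trans ?_
          rw [Measure.restrict_apply_univ, mul_assoc]
          gcongr
          refine (lintegral_mono' hle le_rfl).trans_eq ?_
          rw [lintegral_smul_measure]
          rfl
  have hV : volume (tsupport θ) ≠ ⊤ := hK.measure_lt_top.ne
  have h0 : Tendsto (fun k => ENNReal.ofReal B * (volume (tsupport θ) * C *
        eLpNorm (u k - f) 2 ((Lam m n).restrict (tsupport θ)) ^ 2) ^ (1 / 2 : ℝ)) atTop
      (𝓝 (ENNReal.ofReal B * (volume (tsupport θ) * C * 0 ^ 2) ^ (1 / 2 : ℝ))) := by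
    refine ENNReal.Tendsto.const_mul ?_ (Or.inr (by simp))
    refine (ENNReal.continuous_rpow_const.tendsto _).comp ?_
    refine ENNReal.Tendsto.const_mul (ENNReal.Tendsto.pow hlim) (Or.inr ?_)
    exact ENNReal.mul_ne_top hV hC
  have e0 : ENNReal.ofReal B * (volume (tsupport θ) * C * 0 ^ 2) ^ (1 / 2 : ℝ) = 0 := by simp
  rw [e0] at h0
  exact tendsto_of_tendsto_of_tendsto_of_le_of_le tendsto_const_nhds h0 (fun _ => zero_le) hb

end

/-! ### Completeness: limits of gradients are gradients -/

section

variable {n : ℕ} {m : ℝ}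

theorem exists_subset_box {K : Set (Cyl n)} (hK : Bornology.IsBounded K) (hKH : K ⊆ halfSpace n) :
    ∃ N : ℕ, K ⊆ box 0 (WithLp.toLp 2 fun _ => -((N : ℝ) + 1)) (2 * ((N : ℝ) + 1)) := by
  obtain ⟨C, hC⟩ := hK.exists_norm_le
  obtain ⟨N, hN⟩ := exists_nat_ge C
  refine ⟨N, fun z hz => ⟨⟨hKH hz, ?_⟩, fun j => ?_⟩⟩
  · have h1 := (le_abs_self z.1).trans ((norm_fst_le z).trans ((hC z hz).trans hN))
    linarith [(Nat.cast_nonneg N : (0 : ℝ) ≤ N)]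
  · have h1 : |z.2 j| ≤ N :=
      (PiLp.norm_apply_le z.2 j).trans ((norm_snd_le z).trans ((hC z hz).trans hN))
    rw [abs_le] at h1
    simp only [Set.mem_Ioc]
    constructor <;> linarith [h1.1, h1.2]

theorem ae_mem_halfSpace (m : ℝ) (n : ℕ) : ∀ᵐ z ∂(Lam m n), z ∈ halfSpace n :=
  (Lam_absolutelyContinuous m n).ae_le (ae_restrict_mem (measurableSet_halfSpace n))

theorem ae_of_forall_box {p : Cyl n → Prop}
    (h : ∀ a : ℝ, 0 ≤ a → ∀ (y : EuclideanSpace ℝ (Fin n)) (L : ℝ), 0 < L →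
      ∀ᵐ z ∂((Lam m n).restrict (box a y L)), p z) : ∀ᵐ z ∂(Lam m n), p z := by
  have h1 : ∀ N : ℕ, ∀ᵐ z ∂(Lam m n),
      z ∈ box 0 (WithLp.toLp 2 fun _ => -((N : ℝ) + 1)) (2 * ((N : ℝ) + 1)) → p z := fun N =>
    (ae_restrict_iff' (measurableSet_box _ _ _)).1 (h 0 le_rfl _ _ (by positivity))
  filter_upwards [ae_all_iff.2 h1, ae_mem_halfSpace m n] with z hz hzH
  obtain ⟨N, hN⟩ := exists_subset_box (Bornology.isBounded_singleton (x := z))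
    (Set.singleton_subset_iff.2 hzH)
  exact hz N (hN rfl)

theorem h1Norm_sub_le {w : ℕ → H1 m n} {g : GradSpace m n}
    (hw : ∀ k, ‖gradLp m n (w k) - g‖ ≤ (1 / 2) ^ k) {N k l : ℕ} (hk : N ≤ k) (hl : N ≤ l) :
    h1Norm (w k - w l) ≤ 2 * (1 / 2) ^ N := by
  have anti : ∀ j, N ≤ j → ((1 : ℝ) / 2) ^ j ≤ (1 / 2) ^ N := fun j hj =>
    pow_le_pow_of_le_one (by norm_num) (by norm_num) hj
  rw [← norm_gradLp, map_sub, ← sub_sub_sub_cancel_right _ _ g]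
  refine (norm_sub_le _ _).trans ?_
  linarith [hw k, hw l, anti k hk, anti l hl]

theorem exists_ae_tendsto (hm : 1 ≤ m) (hmn : 2 < m + (n : ℝ)) {w : ℕ → H1 m n}
    {g : GradSpace m n} (hw : ∀ k, ‖gradLp m n (w k) - g‖ ≤ (1 / 2) ^ k) :
    ∃ v : Cyl n → ℂ, ∀ᵐ z ∂(Lam m n),
      Tendsto (fun k => (w k : Cyl n → ℂ) z) atTop (𝓝 (v z)) := by
  have key : ∀ᵐ z ∂(Lam m n), ∃ c : ℂ,
      Tendsto (fun k => (w k : Cyl n → ℂ) z) atTop (𝓝 c) := by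
    refine ae_of_forall_box fun a ha y L hL => ?_
    obtain ⟨M, hM, hMw⟩ := exists_eLpNorm_box_le hm hmn ha y hL
    refine Lp.ae_tendsto_of_cauchy_eLpNorm (p := 2)
      -- The Cauchy criterion needs a summable bound and a strict inequality; the `+ 1` provides
      -- strictness, also when `M = 0`.
      (B := fun k => ENNReal.ofReal ((M * 2 + 1) * (1 / 2) ^ k))
      (fun k => (memLp_box hm (w k) ha y L).1) one_le_two ?_ fun N k l hk hl => ?_
    · have hs : Summable fun k : ℕ => (M * 2 + 1) * ((1 : ℝ) / 2) ^ k :=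
        summable_geometric_two.mul_left _
      rw [← ENNReal.ofReal_tsum_of_nonneg (fun k => by positivity) hs]
      exact ENNReal.ofReal_ne_top
    · refine (hMw (w k - w l)).trans_lt ?_
      rw [ENNReal.ofReal_lt_ofReal_iff (by positivity)]
      have h1 := mul_le_mul_of_nonneg_left (h1Norm_sub_le hw hk hl) hM
      have h2 : (0 : ℝ) < (1 / 2) ^ N := by positivity
      linarith
  classical
  refine ⟨fun z => if h : ∃ c : ℂ, Tendsto (fun k => (w k : Cyl n → ℂ) z) atTop (𝓝 c)
    then h.choose else 0, ?_⟩
  filter_upwards [key] with z hz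
  rw [dif_pos hz]
  exact hz.choose_spec

/-- `v` is the pointwise limit of a sequence in `Ḣ¹` whose gradients converge fast to `g`. -/
structure FastLimit (w : ℕ → H1 m n) (g : GradSpace m n) (v : Cyl n → ℂ) : Prop where
  norm_le : ∀ k, ‖gradLp m n (w k) - g‖ ≤ (1 / 2) ^ k
  tendsto : ∀ᵐ z ∂(Lam m n), Tendsto (fun k => (w k : Cyl n → ℂ) z) atTop (𝓝 (v z))

section limit

variable {w : ℕ → H1 m n} {g : GradSpace m n} {v : Cyl n → ℂ}

/-- Fatou in the second index of the Cauchy estimate for `w k - w l`. -/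
theorem FastLimit.tendsto_eLpNorm_box (hm : 1 ≤ m) (hmn : 2 < m + (n : ℝ)) (h : FastLimit w g v)
    {a : ℝ} (ha : 0 ≤ a) (y : EuclideanSpace ℝ (Fin n)) {L : ℝ}
    (hL : 0 < L) :
    Tendsto (fun k => eLpNorm ((w k : Cyl n → ℂ) - v) 2 ((Lam m n).restrict (box a y L))) atTop
      (𝓝 0) := by
  obtain ⟨M, hM, hMw⟩ := exists_eLpNorm_box_le hm hmn ha y hL
  have hb : ∀ k, eLpNorm ((w k : Cyl n → ℂ) - v) 2 ((Lam m n).restrict (box a y L)) ≤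
      ENNReal.ofReal (M * (2 * (1 / 2) ^ k)) := by
    intro k
    have h1 := Lp.eLpNorm_lim_le_liminf_eLpNorm (p := 2) (μ := (Lam m n).restrict (box a y L))
      (f := fun l => ((w k : Cyl n → ℂ) - (w l : Cyl n → ℂ)))
      (fun l => ((CylSobolev.memLp_box hm (w k) ha y L).sub (CylSobolev.memLp_box hm (w l) ha y L)).1)
      ((w k : Cyl n → ℂ) - v)
      (by
        filter_upwards [ae_restrict_of_ae h.tendsto] with z hz
        exact hz.const_sub _)
    refine h1.trans (liminf_le_of_le (by isBoundedDefault) fun b hb => ?_)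
    obtain ⟨l, hbl, hkl⟩ := (hb.and (eventually_ge_atTop k)).exists
    refine hbl.trans ((hMw (w k - w l)).trans (ENNReal.ofReal_le_ofReal ?_))
    exact mul_le_mul_of_nonneg_left (h1Norm_sub_le h.norm_le le_rfl hkl) hM
  have h0 : Tendsto (fun k : ℕ => ENNReal.ofReal (M * (2 * (1 / 2) ^ k))) atTop (𝓝 0) := by
    rw [← ENNReal.ofReal_zero]
    refine ENNReal.tendsto_ofReal ?_
    have := ((tendsto_pow_atTop_nhds_zero_of_lt_one (r := (1 : ℝ) / 2) (by norm_num)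
      (by norm_num)).const_mul 2).const_mul M
    simpa using this
  exact tendsto_of_tendsto_of_tendsto_of_le_of_le tendsto_const_nhds h0 (fun _ => zero_le) hb

theorem FastLimit.memLp_box (hm : 1 ≤ m) (hmn : 2 < m + (n : ℝ)) (h : FastLimit w g v)
    {a : ℝ} (ha : 0 ≤ a) (y : EuclideanSpace ℝ (Fin n)) {L : ℝ}
    (hL : 0 < L) : MemLp v 2 ((Lam m n).restrict (box a y L)) := by
  have h1 := h.tendsto_eLpNorm_box hm hmn ha y hL
  obtain ⟨k, hk⟩ := (h1.eventually_lt_const ENNReal.zero_lt_top).exists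
  have hvm : AEStronglyMeasurable v ((Lam m n).restrict (box a y L)) :=
    aestronglyMeasurable_of_tendsto_ae atTop (fun k => (CylSobolev.memLp_box hm (w k) ha y L).1)
      (ae_restrict_of_ae h.tendsto)
  have h2 : MemLp ((w k : Cyl n → ℂ) - v) 2 ((Lam m n).restrict (box a y L)) :=
    ⟨(CylSobolev.memLp_box hm (w k) ha y L).1.sub hvm, hk⟩
  have h3 := (CylSobolev.memLp_box hm (w k) ha y L).sub h2
  rwa [sub_sub_cancel] at h3

theorem FastLimit.locallyIntegrableOn (hm : 1 ≤ m) (hmn : 2 < m + (n : ℝ)) (h : FastLimit w g v) :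
    LocallyIntegrableOn v (halfSpace n) volume := by
  refine (locallyIntegrableOn_iff (isOpen_halfSpace n).isLocallyClosed).2 fun K hKH hK => ?_
  obtain ⟨N, hN⟩ := exists_subset_box hK.isBounded hKH
  exact integrableOn_of_memLp_Lam hm hK hKH
    ((h.memLp_box hm hmn le_rfl _ (by positivity)).mono_measure
      (Measure.restrict_mono hN le_rfl))

theorem FastLimit.hasDistGradient (hm : 1 ≤ m) (hmn : 2 < m + (n : ℝ)) (h : FastLimit w g v) :
    HasDistGradient v g := by
  have hvl := h.locallyIntegrableOn hm hmn
  have hg := Lp.memLp g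
  have hgl : LocallyIntegrableOn g (halfSpace n) volume := by
    refine (locallyIntegrableOn_iff (isOpen_halfSpace n).isLocallyClosed).2 fun K hKH hK => ?_
    exact integrableOn_of_memLp_Lam hm hK hKH (hg.mono_measure Measure.restrict_le_self)
  refine ⟨hvl, hgl, fun η h1 h2 h3 i => ?_⟩
  have hd := fun k => hasDistGradient_distGrad (w k)
  have c := continuous_fderiv_dir h1 (coordDir n i)
  have s := tsupport_fderiv_dir η (coordDir n i)
  have hc : HasCompactSupport (fun z => fderiv ℝ η z (coordDir n i)) :=
    h2.mono' ((subset_tsupport _).trans s)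
  have lim1 := tendsto_integral_smul hm hvl (fun k => (hd k).1) c hc (s.trans h3) (by
    obtain ⟨N, hN⟩ := exists_subset_box (IsCompact.isBounded hc) (s.trans h3)
    have h0 := h.tendsto_eLpNorm_box hm hmn le_rfl
      (WithLp.toLp 2 fun _ => -((N : ℝ) + 1)) (L := 2 * ((N : ℝ) + 1)) (by positivity)
    exact tendsto_of_tendsto_of_tendsto_of_le_of_le tendsto_const_nhds h0 (fun _ => zero_le)
      fun k => eLpNorm_mono_measure _ (Measure.restrict_mono hN le_rfl))
  have lim2 := tendsto_integral_smul hm (HasDistGradient.coord hgl i)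
    (fun k => HasDistGradient.coord (hd k).2.1 i) h1.continuous h2 h3 (by
    have h0 : Tendsto (fun k => ENNReal.ofReal ‖gradLp m n (w k) - g‖) atTop (𝓝 0) := by
      rw [← ENNReal.ofReal_zero]
      refine ENNReal.tendsto_ofReal (squeeze_zero (fun k => norm_nonneg _) h.norm_le ?_)
      exact tendsto_pow_atTop_nhds_zero_of_lt_one (by norm_num) (by norm_num)
    refine tendsto_of_tendsto_of_tendsto_of_le_of_le tendsto_const_nhds h0 (fun _ => zero_le)
      fun k => ?_
    change eLpNorm _ 2 _ ≤ ENNReal.ofReal ‖gradLp m n (w k) - g‖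
    rw [Lp.norm_def, ENNReal.ofReal_toReal (Lp.eLpNorm_ne_top _)]
    refine (eLpNorm_mono_measure _ Measure.restrict_le_self).trans (eLpNorm_mono_ae ?_)
    filter_upwards [coeFn_gradLp (w k), Lp.coeFn_sub (gradLp m n (w k)) g] with z hz1 hz2
    rw [hz2, Pi.sub_apply, Pi.sub_apply, hz1]
    exact PiLp.norm_apply_le (distGrad (w k) z - g z) i)
  have e : ∀ k, ∫ z in halfSpace n, fderiv ℝ η z (coordDir n i) • (w k : Cyl n → ℂ) z =
      -∫ z in halfSpace n, η z • (distGrad (w k) z) i := fun k => (hd k).2.2 η h1 h2 h3 i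
  simp_rw [e] at lim1
  exact tendsto_nhds_unique lim1 lim2.neg

/-- `norm_boxAvg_le` cannot be applied to `v - w k`, since the decay of `v` is not yet known. It is
applied to `w l - w k`, and `l → ∞` by `L¹` convergence on the box. -/
theorem FastLimit.norm_boxAvg_sub_le (hm : 1 ≤ m) (hmn : 2 < m + (n : ℝ)) (h : FastLimit w g v)
    (k : ℕ) {a : ℝ} (ha : 0 ≤ a) (y : EuclideanSpace ℝ (Fin n))
    {L : ℝ} (hL : 0 < L) :
    ‖boxAvg m (v - (w k : Cyl n → ℂ)) a y L‖ ≤ avgConst m n L * (2 * (1 / 2) ^ k) := by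
  have := isFiniteMeasure_restrict_box (n := n) hm ha y L
  have := neZero_restrict_box (n := n) hm ha y hL
  have hΛ := Lam_box_pos (n := n) hm ha y hL
  have hΛ' := Lam_box_lt_top (n := n) hm ha y L
  have hA := avgConst_nonneg hmn hL
  have hvi := (h.memLp_box hm hmn ha y hL).integrable one_le_two
  have hwi := fun l => (CylSobolev.memLp_box hm (w l) ha y L).integrable one_le_two
  have h1 : Tendsto (fun l => boxAvg m ((w l : Cyl n → ℂ) - (w k : Cyl n → ℂ)) a y L) atTop
      (𝓝 (boxAvg m (v - (w k : Cyl n → ℂ)) a y L)) := by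
    unfold boxAvg
    simp_rw [average_eq]
    refine Tendsto.const_smul ?_ _
    refine tendsto_integral_of_L1' _ (hvi.sub (hwi k)).1
      (Eventually.of_forall fun l => (hwi l).sub (hwi k)) ?_
    have h0 := h.tendsto_eLpNorm_box hm hmn ha y hL
    have h3 : Tendsto (fun l => eLpNorm ((w l : Cyl n → ℂ) - v) 2
        ((Lam m n).restrict (box a y L)) *
        ((Lam m n).restrict (box a y L)) Set.univ ^ (1 / (1 : ℝ≥0∞).toReal - 1 / (2 : ℝ≥0∞).toReal))
        atTop (𝓝 0) := by
      have := ENNReal.Tendsto.mul_const (b := ((Lam m n).restrict (box a y L)) Set.univ ^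
        (1 / (1 : ℝ≥0∞).toReal - 1 / (2 : ℝ≥0∞).toReal)) h0 (Or.inr (by
          refine ENNReal.rpow_ne_top_of_nonneg (by norm_num) (measure_ne_top _ _)))
      rwa [zero_mul] at this
    refine tendsto_of_tendsto_of_tendsto_of_le_of_le tendsto_const_nhds h3 (fun _ => zero_le)
      fun l => ?_
    rw [sub_sub_sub_cancel_right]
    exact eLpNorm_le_eLpNorm_mul_rpow_measure_univ one_le_two ((hwi l).sub hvi).1
  refine le_of_tendsto h1.norm ?_
  filter_upwards [eventually_ge_atTop k] with l hl
  refine (norm_boxAvg_le hm hmn (w l - w k) ha y hL).trans ?_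
  exact mul_le_mul_of_nonneg_left (h1Norm_sub_le h.norm_le hl le_rfl) hA

/-- Where `|v| > ε`, either `|w k|` or `|v - w k|` exceeds `ε/2`. The first set is finite by
membership of `w k`. For large `k` the averages of `v - w k` over all unit tiles are uniformly
small, so the tiling estimate makes the second finite. -/
theorem FastLimit.measure_lt_top (hm : 1 ≤ m) (hmn : 2 < m + (n : ℝ)) (h : FastLimit w g v)
    (ε : ℝ) (hε : 0 < ε) : Lam m n {z | ε < ‖v z‖} < ⊤ := by
  have h0 : Tendsto (fun k : ℕ => avgConst m n 1 * (2 * (1 / 2 : ℝ) ^ k)) atTop (𝓝 0) := by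
    have := ((tendsto_pow_atTop_nhds_zero_of_lt_one (r := (1 : ℝ) / 2) (by norm_num)
      (by norm_num)).const_mul 2).const_mul (avgConst m n 1)
    simpa using this
  obtain ⟨k, hk⟩ := (h0.eventually_lt_const (by positivity : 0 < ε / 2 / 2)).exists
  set G' : Cyl n → EuclideanSpace ℂ (Fin (n + 1)) := g + (-1 : ℂ) • distGrad (w k)
  have hd : HasDistGradient (v - (w k : Cyl n → ℂ)) G' := by
    have := (h.hasDistGradient hm hmn).add ((hasDistGradient_distGrad (w k)).smul (-1))
    rwa [neg_one_smul ℂ (w k : Cyl n → ℂ), ← sub_eq_add_neg] at this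
  have hG' : MemLp G' 2 (Lam m n) := (Lp.memLp g).add ((memLp_distGrad (w k)).const_smul _)
  set E := {z | z ∈ halfSpace n ∧ ε / 2 < ‖(v - (w k : Cyl n → ℂ)) z‖}
  have hE := hd.measure_le_of_tile hm hG' one_pos (half_pos hε) (E := E) (fun z hz => hz.1)
    (fun z hz => hz.2) fun i _ => by
      refine (h.norm_boxAvg_sub_le hm hmn k (by positivity) _ one_pos).trans hk.le
  have hE' : Lam m n E < ⊤ := by
    have h1 : ENNReal.ofReal ((ε / 2 / 2) ^ 2) ≠ 0 := by simpa using hε.ne'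
    exact ENNReal.lt_top_of_mul_ne_top_right (hE.trans_lt ENNReal.ofReal_lt_top).ne h1
  have hH : Lam m n (halfSpace n)ᶜ = 0 := ae_mem_halfSpace m n
  refine lt_of_le_of_lt (measure_mono (t := ({z | ε / 2 < ‖(w k : Cyl n → ℂ) z‖} ∪ E) ∪
    (halfSpace n)ᶜ) fun z hz => ?_)
    (measure_union_lt_top (measure_union_lt_top (CylSobolev.measure_lt_top (w k) _ (half_pos hε)) hE')
      (by rw [hH]; exact ENNReal.zero_lt_top))
  by_cases hzH : z ∈ halfSpace n
  · left
    by_contra hcon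
    simp only [Set.mem_union, Set.mem_ofPred_eq, not_or, not_lt, E, not_and] at hcon
    have h1 := hcon.2 hzH
    have h2 : ‖v z‖ ≤ ‖(w k : Cyl n → ℂ) z‖ + ‖v z - (w k : Cyl n → ℂ) z‖ :=
      norm_le_norm_add_norm_sub' _ _
    have h3 : ε < ‖v z‖ := hz
    rw [Pi.sub_apply] at h1
    linarith [hcon.1]
  · exact Or.inr hzH

end limit

/-- The gradients of elements of `Ḣ¹` form a closed subspace of `L²(Λ)`. -/
theorem isClosed_range_gradLp (hm : 1 ≤ m) (hmn : 2 < m + (n : ℝ)) :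
    IsClosed ((gradLp m n).range : Set (GradSpace m n)) := by
  refine isClosed_of_closure_subset fun g hg => ?_
  have h1 : ∀ k : ℕ, ∃ u : H1 m n, ‖gradLp m n u - g‖ ≤ (1 / 2) ^ k := by
    intro k
    obtain ⟨_, ⟨u, rfl⟩, hu⟩ := Metric.mem_closure_iff.1 hg ((1 / 2) ^ k) (by positivity)
    refine ⟨u, ?_⟩
    rw [dist_comm, dist_eq_norm] at hu
    exact hu.le
  choose w hw using h1
  obtain ⟨v, hv⟩ := exists_ae_tendsto hm hmn hw
  have h : FastLimit w g v := ⟨hw, hv⟩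
  have hd := h.hasDistGradient hm hmn
  let u : H1 m n := ⟨v, ⟨g, hd, Lp.memLp g⟩, h.measure_lt_top hm hmn⟩
  refine ⟨u, ?_⟩
  refine Lp.ext ((coeFn_gradLp u).trans ?_)
  exact (hasDistGradient_distGrad u).ae_eq_Lam hd

end

/-! ### Weak compactness and the large tile -/

section

/-- Riesz representation and sequential Banach–Alaoglu on the dual. The Riesz map is conjugate
linear, hence the complex conjugations. -/
theorem exists_subseq_weak_tendsto {X : Type*} [NormedAddCommGroup X] [InnerProductSpace ℂ X]
    [CompleteSpace X] [TopologicalSpace.SeparableSpace X] {x : ℕ → X} {C : ℝ}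
    (hx : ∀ j, ‖x j‖ ≤ C) :
    ∃ k : ℕ → ℕ, StrictMono k ∧ ∃ g : X, ∀ f : X →L[ℂ] ℂ,
      Tendsto (fun l => f (x (k l))) atTop (𝓝 (f g)) := by
  have hseq := WeakDual.isSeqCompact_closedBall ℂ X (0 : StrongDual ℂ X) C
  obtain ⟨f₀, -, k, hk, hlim⟩ := hseq
    (x := fun j => StrongDual.toWeakDual (InnerProductSpace.toDual ℂ X (x j))) (by
      intro j
      have h1 : ‖InnerProductSpace.toDual ℂ X (x j)‖ ≤ C := by
        rw [LinearIsometryEquiv.norm_map]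
        exact hx j
      exact mem_closedBall_zero_iff.2 h1)
  refine ⟨k, hk, (InnerProductSpace.toDual ℂ X).symm (WeakDual.toStrongDual f₀), fun f => ?_⟩
  set y := (InnerProductSpace.toDual ℂ X).symm f with hy
  have hf : ∀ z, f z = starRingEnd ℂ (inner ℂ z y) := by
    intro z
    rw [inner_conj_symm, hy, InnerProductSpace.toDual_symm_apply]
  have h1 : Tendsto (fun l => inner ℂ (x (k l)) y) atTop (𝓝 (f₀ y)) :=
    ((WeakDual.eval_continuous y).tendsto f₀).comp hlim
  have h2 : f₀ y = inner ℂ ((InnerProductSpace.toDual ℂ X).symm (WeakDual.toStrongDual f₀)) y := by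
    rw [InnerProductSpace.toDual_symm_apply]
    rfl
  rw [h2] at h1
  simp_rw [hf]
  exact (Complex.continuous_conj.tendsto _).comp h1

/-- A closed subspace equals its double orthogonal complement, and pairing with an orthogonal vector
gives zero along the whole sequence. -/
theorem mem_of_weak_tendsto {X : Type*} [NormedAddCommGroup X] [InnerProductSpace ℂ X]
    [CompleteSpace X] {S : Submodule ℂ X} (hS : IsClosed (S : Set X)) {x : ℕ → X} {g : X}
    (hx : ∀ j, x j ∈ S)
    (hlim : ∀ f : X →L[ℂ] ℂ, Tendsto (fun l => f (x l)) atTop (𝓝 (f g))) : g ∈ S := by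
  have : CompleteSpace S := hS.completeSpace_coe
  rw [← S.orthogonal_orthogonal]
  intro y hy
  have h1 := hlim (innerSL ℂ y)
  have h2 : ∀ l, innerSL ℂ y (x l) = 0 := fun l => by
    rw [innerSL_apply_apply]
    exact Submodule.inner_left_of_mem_orthogonal (hx l) hy
  simp_rw [h2] at h1
  exact tendsto_nhds_unique h1 tendsto_const_nhds

/-- A functional bounded by the norm of the image under a linear map factors through that map. -/
theorem exists_extension_of_bound {V X : Type*} [AddCommGroup V] [Module ℂ V]
    [NormedAddCommGroup X] [NormedSpace ℂ X] (D : V →ₗ[ℂ] X) (L : V →ₗ[ℂ] ℂ) {C : ℝ}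
    (hL : ∀ w, ‖L w‖ ≤ C * ‖D w‖) : ∃ f : X →L[ℂ] ℂ, ∀ w, f (D w) = L w := by
  -- The bound makes `L` descend to the range of `D`; Hahn–Banach then extends it to all of `X`.
  have hker : D.ker ≤ L.ker := by
    intro w hw
    rw [LinearMap.mem_ker] at *
    have := hL w
    rw [hw, norm_zero, mul_zero] at this
    exact norm_le_zero_iff.1 this
  let F : D.range →ₗ[ℂ] ℂ := (D.ker.liftQ L hker).comp D.quotKerEquivRange.symm.toLinearMap
  have hF : ∀ w, F ⟨D w, w, rfl⟩ = L w := by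
    intro w
    have e : D.quotKerEquivRange.symm ⟨D w, w, rfl⟩ = D.ker.mkQ w :=
      D.quotKerEquivRange_symm_apply_image w _
    simp [F, e]
  obtain ⟨f, hf, -⟩ := exists_extension_norm_eq D.range (F.mkContinuous C (by
    rintro ⟨_, w, rfl⟩
    rw [hF]
    exact hL w))
  exact ⟨f, fun w => (hf ⟨D w, w, rfl⟩).trans (hF w)⟩

variable {n : ℕ} {m : ℝ}

/-- Weak sequential compactness of bounded sets of `Ḣ¹`. -/
theorem exists_subseq_weakConv (hm : 1 ≤ m) (hmn : 2 < m + (n : ℝ)) {u : ℕ → H1 m n} {C : ℝ}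
    (hu : ∀ j, h1Norm (u j) ≤ C) :
    ∃ k : ℕ → ℕ, StrictMono k ∧ ∃ v : H1 m n, WeakConv (fun l => u (k l)) v := by
  -- Finiteness of the exponent, for the separability of `L²`.
  have : Fact ((2 : ℝ≥0∞) ≠ ⊤) := ⟨by simp⟩
  obtain ⟨k, hk, g, hg⟩ := exists_subseq_weak_tendsto (x := fun j => gradLp m n (u j))
    (C := C) fun j => (norm_gradLp (u j)).trans_le (hu j)
  obtain ⟨v, rfl⟩ := mem_of_weak_tendsto (isClosed_range_gradLp hm hmn)
    (x := fun l => gradLp m n (u (k l))) (fun l => ⟨u (k l), rfl⟩) hg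
  refine ⟨k, hk, v, fun L ⟨B, hB⟩ => ?_⟩
  obtain ⟨f, hf⟩ := exists_extension_of_bound (gradLp m n) L (C := B) fun w => by
    rw [norm_gradLp]
    exact hB w
  have := hg f
  simp_rw [hf] at this
  exact this

/-- The average over a box as a functional on `Ḣ¹`. -/
def boxAvgFunctional (hm : 1 ≤ m) {a : ℝ} (ha : 0 ≤ a) (y : EuclideanSpace ℝ (Fin n)) (L : ℝ) :
    H1 m n →ₗ[ℂ] ℂ where
  toFun φ := boxAvg m (φ : Cyl n → ℂ) a y L
  map_add' φ ψ := by
    have h (φ : H1 m n) := (hasDistGradient_distGrad φ).integrableOn_box hm (memLp_distGrad φ)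
      ha y L
    simp only [boxAvg, average_eq, Submodule.coe_add]
    rw [← smul_add, ← integral_add (h φ) (h ψ)]
    rfl
  map_smul' c φ := by
    simp only [boxAvg, average_eq, Submodule.coe_smul, Pi.smul_apply, RingHom.id_apply]
    rw [integral_smul, smul_comm]

theorem boxAvg_translate (m : ℝ) (φ : Cyl n → ℂ) (x : EuclideanSpace ℝ (Fin n)) (a : ℝ)
    (y : EuclideanSpace ℝ (Fin n)) (L : ℝ) :
    boxAvg m (fun z => φ (shift x z)) a y L = boxAvg m φ a (y + x) L := by
  have hpre : (shift x : Cyl n → Cyl n) ⁻¹' box a (y + x) L = box a y L := by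
    ext z
    simp only [box, shift, Set.mem_preimage, Set.mem_prod, Set.mem_ofPred_eq, PiLp.add_apply,
      Set.mem_Ioc, add_lt_add_iff_right, add_right_comm _ (x _) L, add_le_add_iff_right]
  have key := measurePreserving_shift_Lam m (n := n) x
  rw [boxAvg, boxAvg, setAverage_eq, setAverage_eq, ← hpre,
    key.setIntegral_preimage_emb (measurableEmbedding_shift x), measureReal_def, measureReal_def,
    key.measure_preimage_emb (measurableEmbedding_shift x)]

/-- If `|φ| > ε` on a non-negligible part of `{ρ ≤ R}`, then some average of `φ` over a small box
close to `{ρ = 0}` is large. -/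
theorem exists_lt_norm_boxAvg (hm : 1 ≤ m) (φ : H1 m n) {C : ℝ} (hC : h1Norm φ ≤ C)
    {ε R δ l : ℝ} (hε : 0 < ε) (hl : 0 < l)
    (hlδ : poincareConst m n * l ^ 2 * C ^ 2 < (ε / 2) ^ 2 * δ)
    (hE : ENNReal.ofReal δ ≤ Lam m n {z : Cyl n | ε < ‖(φ : Cyl n → ℂ) z‖ ∧ z.1 ≤ R})
    {N : ℕ} (hN : R / l ≤ N) :
    ∃ i < N + 1, ∃ x : EuclideanSpace ℝ (Fin n),
      ε / 2 < ‖boxAvg m (φ : Cyl n → ℂ) (i * l) x l‖ := by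
  by_contra! hcon
  set E := {z : Cyl n | ε < ‖(φ : Cyl n → ℂ) z‖ ∧ z.1 ≤ R} ∩ halfSpace n
  have hEE : Lam m n {z : Cyl n | ε < ‖(φ : Cyl n → ℂ) z‖ ∧ z.1 ≤ R} = Lam m n E := by
    refine measure_congr ?_
    filter_upwards [ae_mem_halfSpace m n] with z hz
    exact propext ⟨fun h => ⟨h, hz⟩, fun h => h.1⟩
  have h1 := (hasDistGradient_distGrad φ).measure_le_of_tile hm (memLp_distGrad φ) hl hε (E := E)
    (fun z hz => hz.2) (fun z hz => hz.1.1) (by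
      rintro i ⟨z, hzE, hzi⟩
      refine hcon i.1 ?_ _
      -- A tile meeting `{ρ ≤ R}` has its bottom below `R`; this leaves finitely many layers, a
      -- number independent of `φ`.
      have h2 : (i.1 : ℝ) * l < R := hzi.1.1.trans_le hzE.1.2
      rw [← lt_div_iff₀ hl] at h2
      exact Nat.lt_succ_of_lt (by exact_mod_cast h2.trans_le hN))
  have h2 : ENNReal.ofReal ((ε / 2) ^ 2 * δ) ≤
      ENNReal.ofReal (poincareConst m n * l ^ 2 * h1Norm φ ^ 2) := by
    rw [ENNReal.ofReal_mul (by positivity)]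
    refine le_trans ?_ h1
    rw [← hEE]
    gcongr
  have hP := (poincareConst_pos m n).le
  have hK : 0 ≤ h1Norm φ := ENNReal.toReal_nonneg
  rw [ENNReal.ofReal_le_ofReal_iff (by positivity)] at h2
  have h3 : poincareConst m n * l ^ 2 * h1Norm φ ^ 2 ≤ poincareConst m n * l ^ 2 * C ^ 2 := by
    gcongr
  linarith

end

end CylSobolev

end

open CylSobolev in
theorem theorem6p3 (m : ℝ) (n : ℕ) (hm : 1 ≤ m) (hn : 1 ≤ n) (hmn : 2 < m + (n : ℝ))
    (φ : ℕ → H1 m n) (hbdd : ∃ C : ℝ, ∀ j, h1Norm (φ j) ≤ C)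
    (ε R δ : ℝ) (hε : 0 < ε) (hδ : 0 < δ)
    (hE : ∀ j, ENNReal.ofReal δ ≤
      Lam m n {z : Cyl n | ε < ‖(φ j : Cyl n → ℂ) z‖ ∧ z.1 ≤ R}) :
    ∃ x : ℕ → EuclideanSpace ℝ (Fin n), ∃ k : ℕ → ℕ, StrictMono k ∧
      ∃ v : H1 m n, ¬ ((v : Cyl n → ℂ) =ᵐ[Lam m n] 0) ∧
        WeakConv (fun l => translate (x (k l)) (φ (k l))) v := by
  obtain ⟨C, hC⟩ := hbdd
  obtain ⟨l, hl, hlδ⟩ : ∃ l : ℝ, 0 < l ∧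
      poincareConst m n * l ^ 2 * C ^ 2 < (ε / 2) ^ 2 * δ := by
    have h1 : Tendsto (fun l : ℝ => poincareConst m n * l ^ 2 * C ^ 2) (𝓝[>] 0) (𝓝 0) := by
      have : Continuous fun l : ℝ => poincareConst m n * l ^ 2 * C ^ 2 := by fun_prop
      simpa using (this.tendsto 0).mono_left nhdsWithin_le_nhds
    have h2 : 0 < (ε / 2) ^ 2 * δ := by positivity
    obtain ⟨l, hl1, hl2⟩ := ((h1.eventually_lt_const h2).and self_mem_nhdsWithin).exists
    exact ⟨l, hl2, hl1⟩
  obtain ⟨N, hN⟩ := exists_nat_ge (R / l)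
  choose i hi x hx using fun j => exists_lt_norm_boxAvg hm (φ j) (hC j) hε hl hlδ (hE j) hN
  obtain ⟨k, hk, v, hv⟩ := exists_subseq_weakConv hm hmn
    (u := fun j => translate (x j) (φ j)) (C := C)
    fun j => (h1Norm_translate (x j) (φ j)).trans_le (hC j)
  refine ⟨x, k, hk, v, fun h0 => ?_, hv⟩
  -- The layer of the large tile depends on `j`. Summing over all possible layers avoids a further
  -- subsequence on which it is constant.
  have hlim : Tendsto (fun j => ∑ i ∈ Finset.range (N + 1),
      ‖boxAvg m (translate (x (k j)) (φ (k j)) : Cyl n → ℂ) (i * l) 0 l‖) atTop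
      (𝓝 (∑ i ∈ Finset.range (N + 1), ‖boxAvg m (v : Cyl n → ℂ) (i * l) 0 l‖)) := by
    refine tendsto_finsetSum _ fun i _ => Tendsto.norm ?_
    exact hv (boxAvgFunctional hm (by positivity : 0 ≤ (i : ℝ) * l) 0 l)
      ⟨avgConst m n l, fun w => norm_boxAvg_le hm hmn w (by positivity) 0 hl⟩
  have hzero : ∑ i ∈ Finset.range (N + 1), ‖boxAvg m (v : Cyl n → ℂ) (i * l) 0 l‖ = 0 := by
    refine Finset.sum_eq_zero fun i _ => ?_
    rw [boxAvg, average_congr (ae_restrict_of_ae h0)]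
    simp
  rw [hzero] at hlim
  have hbig : ∀ j, ε / 2 ≤ ∑ i ∈ Finset.range (N + 1),
      ‖boxAvg m (translate (x (k j)) (φ (k j)) : Cyl n → ℂ) (i * l) 0 l‖ := by
    intro j
    refine le_trans ?_ (Finset.single_le_sum
      (f := fun i : ℕ => ‖boxAvg m (translate (x (k j)) (φ (k j)) : Cyl n → ℂ) (i * l) 0 l‖)
      (fun i _ => norm_nonneg _) (Finset.mem_range.2 (hi (k j))))
    have e := boxAvg_translate m (φ (k j) : Cyl n → ℂ) (x (k j)) (i (k j) * l) 0 l
    rw [zero_add] at e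
    refine (hx (k j)).le.trans_eq ?_
    rw [← e]
    rfl
  have := ge_of_tendsto' hlim hbig
  linarith
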